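/- Let $\mathcal M\subseteq\mathbb R^n$ be a set of generalized coordinates $q$ and $\mathcal D=\mathcal M\times\mathbb R^n$. Consider the mechanical system with state $x=(q,v)\in\mathcal D$ and input $u\in\mathbb R^n$, $$\dot q=v,\qquad \dot v=M(q)^{-1}\bigl(-C(q,v)v-\tau_g(q)+u\bigr),$$ written as $\dot x=f(x)+g(x)u$, where $f$ and $g$ are locally Lipschitz on $\mathcal D$ and $M(q)$ is positive definite ($w^TM(q)w>0$ for $w\ne0$) for every $q\in\mathcal M$. Let $K_p,K_d,P_v\in\mathbb R^{n\times n}$ be symmetric positive definite, $P_q\in\mathbb R^{n\times n}$ symmetric, $b>0$, and put $$k(x)=C(q,v)v+\tau_g(q)+M(q)(-K_pq-K_dv),\quad V(x)=\tfrac12(q^TK_pq+v^Tv),\quad h(x)=b-\tfrac12(q^TP_qq+v^TP_vv),$$ $\mathcal C=\{x\in\mathcal D: h(x)\ge0\}$, $\Gamma_\nu=\{x\in\mathcal D:V(x)\le\nu\}$ for $\nu>0$, and $G=M^{-T}M^{-1}$. Let $L_fh=\nabla h^Tf$, $L_gh=\nabla h^Tg$. Assume that $h$ is a ZCBF on an open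 set $\mathcal E$ with $\mathcal C\subseteq\mathcal E\subseteq\mathcal D$: $\alpha:\mathbb R\to\mathbb R$ is locally Lipschitz and strictly increasing with $\alpha(0)=0$, and $\sup_{u\in\mathbb R^n}[L_fh(x)+L_gh(x)u+\alpha(h(x))]\ge0$ for all $x\in\mathcal E$. Assume also $0\in\operatorname{Int}\mathcal C$. (i) For every $\nu>0$, $\Gamma_\nu$ is CBF-stabilizable. That is: $G$ is locally Lipschitz and symmetric positive definite on $\mathcal D$; $k$ is locally Lipschitz on $\mathcal D$ and makes the origin an asymptotically stable equilibrium on $\mathcal D$; $V$ is continuously differentiable on $\mathcal D$, $V(0)=0$, $V>0$ on $\mathcal D\setminus\{0\}$, $\dot V=\nabla V^T(f+gk)\le0$ on $\mathcal D$, and the only solution on $[0,\infty)$ of $\dot x=f(x)+g(x)k(x)$ in $\mathcal D$ that stays in $\{\dot V=0\}$ is $x\equiv0$; and there is a set $\mathcal A\subseteq\Gamma_\nu\cap\mathcal C$ such that $\nabla V^TgG^{-1}g^T\nabla h<0$ on $(\Gamma_\nu\cap\mathcal C)\setminus\mathcal A$ and $L_fh+L_gh\,k+\alpha(h)\ge0$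 on $\mathcal A$. (ii) Let $\nu>0$ be such that $\{(q,v)\in\mathbb R^{2n}:V(q,v)\le\nu\}\subseteq\mathcal M\times\mathbb R^n$, and suppose that either $L_gh(x)\neq0$ for all $x\in\Gamma_\nu\cap\mathcal E$, or every $x\in\Gamma_\nu\cap\mathcal E$ with $L_gh(x)=0$ satisfies $x\in\operatorname{Int}\mathcal C$ and $\nabla h(x)=0$. For $x\in\mathcal E$ and $\mu\in\mathbb R^n$ let $k_\mu(x)=C(q,v)v+\tau_g(q)+M(q)(-K_pq+\mu)$, so that $k_\mu=k$ for $\mu=-K_dv$. Then for all $x\in\mathcal E$ and $\mu\in\mathbb R^n$ the quadratic program $$\min_{u\in\mathbb R^n}\ \tfrac12(u-k_\mu(x))^TG(x)(u-k_\mu(x))\quad\text{s.t.}\quad L_fh(x)+L_gh(x)u\ge-\alpha(h(x))$$ has a unique solution $u^*_\mu(x)$. Let $u^*(x)$ be the solution for $\mu=-K_dv$, that is, with nominal control $k(x)$. The closed loop $\dot x=f(x)+g(x)u^*(x)$ on $\mathcal E$ satisfies: 1. from every $x(0)\in\Gamma_\nu\cap\mathcal C$ there is a unique solution; it exists for all $t\ge0$,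 and $x(t)\in\Gamma_\nu\cap\mathcal C$ for all $t\ge0$; 2. the origin is an asymptotically stable equilibrium, and every solution starting in $\Gamma_\nu\cap\mathcal C$ converges to it; 3. it is passive with respect to the input term $\mu=-K_dv$ and the output $v$, with storage function $V$: $\nabla V(x)^T(f(x)+g(x)u^*(x))\le\mu^Tv$ with $\mu=-K_dv$, for all $x\in\mathcal E$. More generally, with $\mu$ as a free input, $\nabla V(x)^T(f(x)+g(x)u^*_\mu(x))\le\mu^Tv$ for all $x\in\mathcal E$ and $\mu\in\mathbb R^n$, where $V$ is continuously differentiable, $V\ge0$ and $V(0)=0$. -/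

import Mathlib

open Set Filter Topology

noncomputable section

namespace SafeControl

/-- Euclidean space with coordinates indexed by `ι`. -/
abbrev Vec (ι : Type) [Fintype ι] : Type := EuclideanSpace ℝ ι

section General

variable {ι κ : Type} [Fintype ι] [Fintype κ] [DecidableEq κ]

/-- Matrix times vector, on Euclidean spaces. -/
def matVec (A : Matrix ι κ ℝ) (w : Vec κ) : Vec ι := WithLp.toLp 2 (A.mulVec w.ofLp)

/-- The weighted square `‖w‖²_A = wᵀ A w`. -/
def weightedSq (A : Matrix κ κ ℝ) (w : Vec κ) : ℝ := inner ℝ w (matVec A w)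

/-- A matrix valued map is locally Lipschitz on `D` (entrywise). -/
def MatLocLipOn {X r c : Type} [PseudoEMetricSpace X] (D : Set X) (A : X → Matrix r c ℝ) : Prop :=
  ∀ i j, LocallyLipschitzOn D (fun x => A x i j)

/-- Extended class-K functions. -/
def IsExtClassK (α : ℝ → ℝ) : Prop := Continuous α ∧ StrictMono α ∧ α 0 = 0

/-- The Lie derivative `L_f h`. -/
def lieF (f : Vec ι → Vec ι) (h : Vec ι → ℝ) (x : Vec ι) : ℝ := inner ℝ (gradient h x) (f x)

/-- The (transposed) Lie derivative `(L_g h)ᵀ = gᵀ ∇h`, a vector in the input space. -/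
def lieG (g : Vec ι → Matrix ι κ ℝ) (h : Vec ι → ℝ) (x : Vec ι) : Vec κ :=
  matVec (g x).transpose (gradient h x)

/-- The closed-loop vector field `f + g u` under the feedback `u`. -/
def closedLoop (f : Vec ι → Vec ι) (g : Vec ι → Matrix ι κ ℝ) (u : Vec ι → Vec κ) :
    Vec ι → Vec ι := fun x => f x + matVec (g x) (u x)

/-- The constraint set `{x : h x ≥ 0}` inside the state space `D`. -/
def constraintSet (D : Set (Vec ι)) (h : Vec ι → ℝ) : Set (Vec ι) := {x ∈ D | 0 ≤ h x}

/-- The sublevel set `Γ_ν` of `V` inside the state space `D`. -/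
def levelSet (D : Set (Vec ι)) (V : Vec ι → ℝ) (ν : ℝ) : Set (Vec ι) := {x ∈ D | V x ≤ ν}

/-- `h` is a continuously differentiable zeroing control barrier function on the open set `E`,
`C ⊆ E ⊆ D`, with the locally Lipschitz extended class-K function `α`, and `0 ∈ Int C`.
The supremum over the inputs is taken in the extended reals, since it may be `+∞`. -/
structure ZCBFAssumption (D : Set (Vec ι)) (f : Vec ι → Vec ι) (g : Vec ι → Matrix ι κ ℝ)
    (h : Vec ι → ℝ) (E : Set (Vec ι)) (α : ℝ → ℝ) : Prop where
  isOpen : IsOpen E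
  constraint_subset : constraintSet D h ⊆ E
  subset_domain : E ⊆ D
  contDiff : ContDiffOn ℝ 1 h E
  classK : IsExtClassK α
  locLip : LocallyLipschitz α
  sup_nonneg : ∀ x ∈ E,
    (0 : EReal) ≤ ⨆ u : Vec κ, ((lieF f h x + inner ℝ (lieG g h x) u + α (h x) : ℝ) : EReal)
  zero_mem_interior : (0 : Vec ι) ∈ interior (constraintSet D h)

/-- `x` solves `x' = F x` on the time set `I`, with values in `Ω`. -/
def IsSolution (Ω : Set (Vec ι)) (F : Vec ι → Vec ι) (I : Set ℝ) (x : ℝ → Vec ι) : Prop :=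
  ∀ t ∈ I, x t ∈ Ω ∧ HasDerivWithinAt x (F (x t)) I t

/-- The origin is an asymptotically stable equilibrium of `x' = F x` on `Ω`: solutions that start
near the origin exist for all positive times, stay near the origin and converge to it. -/
structure AsymptoticallyStable (Ω : Set (Vec ι)) (F : Vec ι → Vec ι) : Prop where
  equilibrium : (0 : Vec ι) ∈ Ω ∧ F 0 = 0
  stable : ∀ ε > 0, ∃ δ > 0, ∀ x₀ : Vec ι, ‖x₀‖ < δ →
    (∃ x, IsSolution Ω F (Ici 0) x ∧ x 0 = x₀) ∧
    ∀ (T : ℝ) (x : ℝ → Vec ι), IsSolution Ω F (Ico 0 T) x → x 0 = x₀ → ∀ t ∈ Ico 0 T, ‖x t‖ < ε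
  attractive : ∃ δ > 0, ∀ x, IsSolution Ω F (Ici 0) x → ‖x 0‖ < δ → Tendsto x atTop (𝓝 0)

/-- From every point of `S` there starts a solution on `[0, ∞)` that stays in `S`, and every other
solution from that point, on any interval `[0, T)`, agrees with it. -/
def InvariantForAllTime (Ω : Set (Vec ι)) (F : Vec ι → Vec ι) (S : Set (Vec ι)) : Prop :=
  ∀ x₀ ∈ S, ∃ x, IsSolution Ω F (Ici 0) x ∧ x 0 = x₀ ∧ (∀ t, 0 ≤ t → x t ∈ S) ∧
    ∀ (T : ℝ) (y : ℝ → Vec ι), IsSolution Ω F (Ico 0 T) y → y 0 = x₀ → EqOn y x (Ico 0 T)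

/-- Every solution on `[0, ∞)` that starts in `S` converges to the origin. -/
def AttractedFrom (Ω : Set (Vec ι)) (F : Vec ι → Vec ι) (S : Set (Vec ι)) : Prop :=
  ∀ x, IsSolution Ω F (Ici 0) x → x 0 ∈ S → Tendsto x atTop (𝓝 0)

/-- The locally Lipschitz control law `k` makes the origin an asymptotically stable equilibrium
on `D`, with the (weak) Lyapunov function `V`, and LaSalle's condition holds: the only solution
that stays where the derivative of `V` along the dynamics vanishes is the zero solution. -/
structure LyapunovAssumption (D : Set (Vec ι)) (f : Vec ι → Vec ι) (g : Vec ι → Matrix ι κ ℝ)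
    (k : Vec ι → Vec κ) (V : Vec ι → ℝ) : Prop where
  locLip : LocallyLipschitzOn D k
  contDiff : ContDiffOn ℝ 1 V D
  map_zero : V 0 = 0
  pos : ∀ x ∈ D, x ≠ 0 → 0 < V x
  nonincreasing : ∀ x ∈ D, lieF (closedLoop f g k) V x ≤ 0
  stable : AsymptoticallyStable D (closedLoop f g k)
  laSalle : ∀ x, IsSolution D (closedLoop f g k) (Ici 0) x →
    (∀ t, 0 ≤ t → lieF (closedLoop f g k) V (x t) = 0) → ∀ t, 0 ≤ t → x t = 0

/-- `Γ_ν` is CBF-stabilizable (for `k`, `V`, `h`, `α` and the weight matrix `G`). -/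
structure CBFStabilizable (D : Set (Vec ι)) (f : Vec ι → Vec ι) (g : Vec ι → Matrix ι κ ℝ)
    (h : Vec ι → ℝ) (E : Set (Vec ι)) (α : ℝ → ℝ) (k : Vec ι → Vec κ) (V : Vec ι → ℝ)
    (G : Vec ι → Matrix κ κ ℝ) (ν : ℝ) : Prop where
  zcbf : ZCBFAssumption D f g h E α
  lyapunov : LyapunovAssumption D f g k V
  weight_locLip : MatLocLipOn D G
  weight_posDef : ∀ x ∈ D, (G x).PosDef
  level_pos : 0 < ν
  exists_exceptional_set : ∃ A ⊆ levelSet D V ν ∩ constraintSet D h,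
    (∀ x ∈ (levelSet D V ν ∩ constraintSet D h) \ A,
      inner ℝ (gradient V x)
        (matVec (g x * (G x)⁻¹ * (g x).transpose) (gradient h x)) < 0) ∧
    ∀ x ∈ A, 0 ≤ lieF f h x + inner ℝ (lieG g h x) (k x) + α (h x)

/-- The regularity condition on `L_g h` on the set `S`. -/
def LieRegular (D : Set (Vec ι)) (g : Vec ι → Matrix ι κ ℝ) (h : Vec ι → ℝ)
    (E S : Set (Vec ι)) : Prop :=
  (∀ x ∈ S ∩ E, lieG g h x ≠ 0) ∨
  (∀ x ∈ S ∩ E, lieG g h x = 0 →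
    x ∈ S ∩ interior (constraintSet D h) ∧ gradient h x = 0)

/-- The constraint of the quadratic program at `x`. -/
def QPFeasible (f : Vec ι → Vec ι) (g : Vec ι → Matrix ι κ ℝ) (h : Vec ι → ℝ) (α : ℝ → ℝ)
    (x : Vec ι) (u : Vec κ) : Prop :=
  lieF f h x + inner ℝ (lieG g h x) u ≥ -α (h x)

/-- `u` minimizes `½ ‖u - u₀‖²_G` subject to `L_f h + L_g h u ≥ -α(h)` at the state `x`. -/
def IsQPSolution (f : Vec ι → Vec ι) (g : Vec ι → Matrix ι κ ℝ) (h : Vec ι → ℝ) (α : ℝ → ℝ)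
    (G : Vec ι → Matrix κ κ ℝ) (u₀ : Vec κ) (x : Vec ι) (u : Vec κ) : Prop :=
  QPFeasible f g h α x u ∧
    ∀ w, QPFeasible f g h α x w → 1 / 2 * weightedSq (G x) (u - u₀) ≤ 1 / 2 * weightedSq (G x) (w - u₀)

/-- The system `x' = F x μ` with input `μ` and output `y x` is passive on `Ω`, with the storage
function `S`. -/
structure PassiveWith (Ω : Set (Vec ι)) (F : Vec ι → Vec κ → Vec ι) (y : Vec ι → Vec κ)
    (S : Vec ι → ℝ) : Prop where
  contDiff : ContDiffOn ℝ 1 S Ω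
  map_zero : S 0 = 0
  nonneg : ∀ x ∈ Ω, 0 ≤ S x
  dissipation : ∀ x ∈ Ω, ∀ μ : Vec κ, inner ℝ (gradient S x) (F x μ) ≤ inner ℝ μ (y x)

end General

section Mechanical

variable {n : ℕ}

/-- States `(q, v)` of a mechanical system with `n` degrees of freedom. -/
abbrev MechState (n : ℕ) : Type := Vec (Fin n ⊕ Fin n)

/-- Generalized coordinates. -/
def pos (x : MechState n) : Vec (Fin n) := WithLp.toLp 2 fun i => x (Sum.inl i)

/-- Generalized velocities. -/
def vel (x : MechState n) : Vec (Fin n) := WithLp.toLp 2 fun i => x (Sum.inr i)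

/-- The state space of pairs `(q, v)` with `q` in the configuration set. -/
def mechDomain (Q : Set (Vec (Fin n))) : Set (MechState n) := {x | pos x ∈ Q}

/-- The drift `(v, M⁻¹ (-C v - τ))`. -/
def mechDrift (M : Vec (Fin n) → Matrix (Fin n) (Fin n) ℝ)
    (C : Vec (Fin n) → Vec (Fin n) → Matrix (Fin n) (Fin n) ℝ) (τ : Vec (Fin n) → Vec (Fin n))
    (x : MechState n) : MechState n :=
  WithLp.toLp 2 (Sum.elim (vel x).ofLp
    (matVec (M (pos x))⁻¹ (-matVec (C (pos x) (vel x)) (vel x) - τ (pos x))).ofLp)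

/-- The input matrix `(0, M⁻¹)`. -/
def mechInput (M : Vec (Fin n) → Matrix (Fin n) (Fin n) ℝ) (x : MechState n) :
    Matrix (Fin n ⊕ Fin n) (Fin n) ℝ := Matrix.fromRows 0 (M (pos x))⁻¹

/-- The control `C v + τ + M (-K_p q + μ)`, with the input term `μ`. -/
def torqueWithInput (M : Vec (Fin n) → Matrix (Fin n) (Fin n) ℝ)
    (C : Vec (Fin n) → Vec (Fin n) → Matrix (Fin n) (Fin n) ℝ) (τ : Vec (Fin n) → Vec (Fin n))
    (Kp : Matrix (Fin n) (Fin n) ℝ) (x : MechState n) (μ : Vec (Fin n)) : Vec (Fin n) :=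
  matVec (C (pos x) (vel x)) (vel x) + τ (pos x) + matVec (M (pos x)) (-matVec Kp (pos x) + μ)

/-- The computed torque control `C v + τ + M (-K_p q - K_d v)`. -/
def computedTorque (M : Vec (Fin n) → Matrix (Fin n) (Fin n) ℝ)
    (C : Vec (Fin n) → Vec (Fin n) → Matrix (Fin n) (Fin n) ℝ) (τ : Vec (Fin n) → Vec (Fin n))
    (Kp Kd : Matrix (Fin n) (Fin n) ℝ) (x : MechState n) : Vec (Fin n) :=
  torqueWithInput M C τ Kp x (-matVec Kd (vel x))

/-- `V = ½ (qᵀ K_p q + vᵀ v)`. -/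
def mechLyapunov (Kp : Matrix (Fin n) (Fin n) ℝ) (x : MechState n) : ℝ :=
  1 / 2 * (weightedSq Kp (pos x) + inner ℝ (vel x) (vel x))

/-- `h = b - ½ (qᵀ P_q q + vᵀ P_v v)`. -/
def mechBarrier (b : ℝ) (Pq Pv : Matrix (Fin n) (Fin n) ℝ) (x : MechState n) : ℝ :=
  b - 1 / 2 * (weightedSq Pq (pos x) + weightedSq Pv (vel x))

/-- `G = M⁻ᵀ M⁻¹`. -/
def mechWeight (M : Vec (Fin n) → Matrix (Fin n) (Fin n) ℝ) (x : MechState n) :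
    Matrix (Fin n) (Fin n) ℝ := (M (pos x))⁻¹.transpose * (M (pos x))⁻¹

end Mechanical

end SafeControl

end

open SafeControl

/-! In the acceleration variable `w = M⁻¹(u - k_μ)` the system is `q' = v`, `v' = -K_p q + μ + w`.
The weight `G` turns the cost into `½‖w‖²`, and the barrier constraint becomes a half-space with
normal `-P_v v`. The quadratic program is therefore a nearest-point problem (`halfspace_projection`,
`isQPSolution_iff`), and its solution is `w = -c(x) P_v v` with `c ≥ 0`: the safety filter only adds
damping. Hence `V' = μᵀv - c vᵀP_v v ≤ μᵀv`, which is passivity.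

The vector `L_g h` vanishes at every state at rest. Such states fill a neighbourhood of the origin
in the plane `v = 0`, so the regularity condition forces `∇h = -(P_q q, 0)` to vanish there, that
is, `P_q = 0` (`eq_zero_of_lieRegular`). Then `h = b` at rest, the constraint is strictly slack
nearby, and `c` is zero near `v = 0`. This removes the singularity of the gain and makes the closed
loop locally Lipschitz (`locallyLipschitz_gain`).

On `E` the closed loop thus agrees with a damped field on the whole space. Sublevel sets of `V` are
bounded, which gives its solutions for all time. Convergence follows from the strict Lyapunov
function `V + ε qᵀv` (`tendsto_zero_of_dampedField`). The barrier cannot become negative because it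
increases wherever it is negative (`barrier_derivative_nonneg`). -/

noncomputable section

namespace SafeControl

/-! ### Calculus of locally Lipschitz maps and matrices -/

section LocallyLipschitz

variable {X : Type} [PseudoEMetricSpace X] {D : Set X}

/-- A C¹ map is Lipschitz near each point. Sums, products, coordinates and matrix inverses all
reduce to this case. -/
theorem _root_.LocallyLipschitzOn.comp_contDiffAt {V W : Type*} [NormedAddCommGroup V]
    [NormedSpace ℝ V] [NormedAddCommGroup W] [NormedSpace ℝ W] {f : X → V} {Φ : V → W}
    (hf : LocallyLipschitzOn D f) (hΦ : ∀ x ∈ D, ContDiffAt ℝ 1 Φ (f x)) :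
    LocallyLipschitzOn D (fun x => Φ (f x)) := by
  intro x hx
  obtain ⟨K, t, ht, hK⟩ := hf hx
  obtain ⟨L, s, hs, hL⟩ := (hΦ x hx).exists_lipschitzOnWith
  refine ⟨L * K, t ∩ f ⁻¹' s, inter_mem ht (hf.continuousOn x hx hs), ?_⟩
  exact hL.comp (hK.mono inter_subset_left) fun y hy => hy.2

theorem _root_.LocallyLipschitzOn.pi {ι : Type*} [Fintype ι] {f : X → ι → ℝ}
    (hf : ∀ i, LocallyLipschitzOn D (fun x => f x i)) : LocallyLipschitzOn D f := by
  intro x hx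
  choose K t ht hK using fun i => hf i hx
  refine ⟨∑ i, K i, ⋂ i, t i, iInter_mem.2 ht, fun y hy z hz => ?_⟩
  rw [edist_pi_le_iff]
  intro i
  refine (hK i (mem_iInter.1 hy i) (mem_iInter.1 hz i)).trans ?_
  gcongr
  exact Finset.single_le_sum (f := K) (fun _ _ => zero_le) (Finset.mem_univ i)

theorem _root_.LocallyLipschitzOn.congr {Y : Type*} [PseudoEMetricSpace Y] {f g : X → Y}
    (hf : LocallyLipschitzOn D f) (h : EqOn g f D) : LocallyLipschitzOn D g := by
  intro x hx
  obtain ⟨K, t, ht, hK⟩ := hf hx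
  refine ⟨K, t ∩ D, inter_mem ht self_mem_nhdsWithin, fun y hy z hz => ?_⟩
  rw [h hy.2, h hz.2]
  exact hK hy.1 hz.1

theorem _root_.LocallyLipschitzOn.real_mul {f g : X → ℝ} (hf : LocallyLipschitzOn D f)
    (hg : LocallyLipschitzOn D g) : LocallyLipschitzOn D (fun x => f x * g x) := by
  have h : LocallyLipschitzOn D (fun x => ![f x, g x]) :=
    LocallyLipschitzOn.pi fun i => by fin_cases i <;> assumption
  exact h.comp_contDiffAt (Φ := fun p : Fin 2 → ℝ => p 0 * p 1) fun _ _ => by fun_prop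

theorem _root_.LocallyLipschitzOn.real_sum {ι : Type*} [Fintype ι] {f : ι → X → ℝ}
    (hf : ∀ i, LocallyLipschitzOn D (f i)) : LocallyLipschitzOn D (fun x => ∑ i, f i x) :=
  (LocallyLipschitzOn.pi (f := fun x i => f i x) hf).comp_contDiffAt
    (Φ := fun p => ∑ i, p i) fun _ _ => by fun_prop

variable {ι κ l : Type} [Fintype ι] [Fintype κ] [Fintype l]

theorem locallyLipschitzOn_vec {f : X → Vec ι} :
    LocallyLipschitzOn D f ↔ ∀ i, LocallyLipschitzOn D (fun x => f x i) := by
  refine ⟨fun h i => h.comp_contDiffAt (Φ := fun w : Vec ι => w i) fun _ _ => by fun_prop,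
    fun h => ?_⟩
  exact (LocallyLipschitzOn.pi (f := fun x i => f x i) h).comp_contDiffAt
    (Φ := (WithLp.toLp 2 : (ι → ℝ) → Vec ι)) fun _ _ =>
      (EuclideanSpace.equiv ι ℝ).symm.contDiff.contDiffAt

omit [Fintype ι] [Fintype l] in
theorem MatLocLipOn.mul {A : X → Matrix ι κ ℝ} {B : X → Matrix κ l ℝ} (hA : MatLocLipOn D A)
    (hB : MatLocLipOn D B) : MatLocLipOn D (fun x => A x * B x) := fun i j => by
  simp only [Matrix.mul_apply]
  exact LocallyLipschitzOn.real_sum fun k => (hA i k).real_mul (hB k j)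

omit [Fintype ι] [Fintype κ] in
theorem MatLocLipOn.transpose {A : X → Matrix ι κ ℝ} (hA : MatLocLipOn D A) :
    MatLocLipOn D (fun x => (A x).transpose) := fun i j => hA j i

theorem MatLocLipOn.matVec {A : X → Matrix ι κ ℝ} {w : X → Vec κ} (hA : MatLocLipOn D A)
    (hw : LocallyLipschitzOn D w) : LocallyLipschitzOn D (fun x => matVec (A x) (w x)) := by
  rw [locallyLipschitzOn_vec] at hw ⊢
  intro i
  exact LocallyLipschitzOn.real_sum fun k => (hA i k).real_mul (hw k)

theorem contDiff_det [DecidableEq κ] {V : Type*} [NormedAddCommGroup V] [NormedSpace ℝ V]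
    {f : V → Matrix κ κ ℝ} (hf : ∀ i j, ContDiff ℝ 1 (fun x => f x i j)) :
    ContDiff ℝ 1 (fun x => (f x).det) := by
  simp only [Matrix.det_apply, Units.smul_def, zsmul_eq_mul]
  exact ContDiff.sum fun σ _ => contDiff_const.mul (contDiff_prod fun i _ => hf _ _)

/-- Cramer's rule: the entry is a quotient of two determinants, so no norm on matrices is needed. -/
theorem contDiffAt_inv_apply [DecidableEq κ] {V : Type*} [NormedAddCommGroup V] [NormedSpace ℝ V]
    {f : V → Matrix κ κ ℝ} (hf : ∀ i j, ContDiff ℝ 1 (fun x => f x i j)) {x : V}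
    (hx : (f x).det ≠ 0) (i j : κ) : ContDiffAt ℝ 1 (fun x => (f x)⁻¹ i j) x := by
  have hadj : ContDiff ℝ 1 (fun x => ((f x).updateRow j (Pi.single i 1)).det) := by
    refine contDiff_det fun k m => ?_
    by_cases hk : k = j
    · simp only [hk, Matrix.updateRow_self]
      exact contDiff_const
    · simpa only [Matrix.updateRow_ne hk] using hf k m
  have heq : (fun x => (f x)⁻¹ i j) =
      fun x => (f x).det⁻¹ * ((f x).updateRow j (Pi.single i 1)).det := by
    funext y
    rw [Matrix.inv_def, Ring.inverse_eq_inv', Matrix.smul_apply, smul_eq_mul,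
      Matrix.adjugate_apply]
  rw [heq]
  exact ((contDiff_det hf).contDiffAt.inv hx).mul hadj.contDiffAt

theorem MatLocLipOn.inv [DecidableEq κ] {A : X → Matrix κ κ ℝ} (hA : MatLocLipOn D A)
    (h : ∀ x ∈ D, (A x).det ≠ 0) : MatLocLipOn D (fun x => (A x)⁻¹) := fun i j =>
  (LocallyLipschitzOn.pi (f := fun x (p : κ × κ) => A x p.1 p.2)
    fun p => hA p.1 p.2).comp_contDiffAt
    (Φ := fun a => (Matrix.of fun i j => a (i, j))⁻¹ i j) fun x hx =>
      contDiffAt_inv_apply (f := fun a : κ × κ → ℝ => Matrix.of fun i j => a (i, j))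
        (x := fun p => A x p.1 p.2) (fun i j => contDiff_apply ℝ ℝ (i, j)) (h x hx) i j

end LocallyLipschitz

/-! ### Comparison, uniqueness and global existence for differential equations -/

section ODE

theorem antitoneOn_of_hasDerivWithinAt {I : Set ℝ} (hI : Convex ℝ I) {y y' : ℝ → ℝ}
    (hy : ∀ t ∈ I, HasDerivWithinAt y (y' t) I t) (hy' : ∀ t ∈ I, y' t ≤ 0) : AntitoneOn y I :=
  antitoneOn_of_hasDerivWithinAt_nonpos hI (fun t ht => (hy t ht).continuousWithinAt)
    (fun t ht => (hy t (interior_subset ht)).mono interior_subset)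
    fun t ht => hy' t (interior_subset ht)

/-- A function on `[0, ∞)` that starts nonnegative and increases while it is negative stays
nonnegative. -/
theorem nonneg_of_hasDerivWithinAt_nonneg {y y' : ℝ → ℝ}
    (hy : ∀ t ∈ Ici (0 : ℝ), HasDerivWithinAt y (y' t) (Ici 0) t) (h0 : 0 ≤ y 0)
    (hy' : ∀ t ∈ Ici (0 : ℝ), y t < 0 → 0 ≤ y' t) : ∀ t ∈ Ici (0 : ℝ), 0 ≤ y t := by
  intro t ht
  refine le_of_forall_pos_le_add fun ε hε => ?_
  have ht' : (0 : ℝ) < 1 + t := by linarith [mem_Ici.1 ht]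
  -- The barrier for `-y` is a line of positive slope with value `ε` at time `t`. Where `-y` touches
  -- it, `y < 0`, so `-y` has slope at most zero and cannot cross.
  have key := image_le_of_deriv_right_lt_deriv_boundary' (f := fun s => -y s)
    (f' := fun s => -y' s) (a := 0) (b := t) (B := fun s => ε / (1 + t) * (1 + s))
    (B' := fun _ => ε / (1 + t))
    (fun s hs => ((hy s hs.1).continuousWithinAt.mono Icc_subset_Ici_self).neg)
    (fun s hs => ((hy s hs.1).mono (Ici_subset_Ici.2 hs.1)).neg)
    (by simp only [add_zero, mul_one]; have : 0 < ε / (1 + t) := by positivity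
        linarith)
    (by fun_prop)
    (fun s hs => by
      simpa using (((hasDerivAt_id s).const_add 1).const_mul (ε / (1 + t))).hasDerivWithinAt)
    (fun s hs h => by
      have h1 : 0 < ε / (1 + t) * (1 + s) := by have := hs.1; positivity
      have h2 : 0 < ε / (1 + t) := by positivity
      have := hy' s hs.1 (by linarith)
      linarith)
    (right_mem_Icc.2 ht)
  rw [div_mul_cancel₀ _ ht'.ne'] at key
  linarith

variable {W : Type*} [NormedAddCommGroup W] [NormedSpace ℝ W] [ProperSpace W]

/-- Two solutions of `x' = F x` on `[0, T]` that stay in a ball and start at the same point agree. -/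
theorem eqOn_of_solutions {F : W → W} (hF : LocallyLipschitz F) {R T : ℝ} {x y : ℝ → W}
    (hx : ∀ t ∈ Icc 0 T, HasDerivWithinAt x (F (x t)) (Icc 0 T) t)
    (hy : ∀ t ∈ Icc 0 T, HasDerivWithinAt y (F (y t)) (Icc 0 T) t)
    (hxR : ∀ t ∈ Icc 0 T, ‖x t‖ ≤ R) (hyR : ∀ t ∈ Icc 0 T, ‖y t‖ ≤ R) (h0 : x 0 = y 0) :
    EqOn x y (Icc 0 T) := by
  obtain ⟨K, hK⟩ := (hF.locallyLipschitzOn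
    (s := Metric.closedBall 0 R)).exists_lipschitzOnWith_of_compact (isCompact_closedBall _ _)
  have right {z : ℝ → W} (hz : ∀ t ∈ Icc 0 T, HasDerivWithinAt z (F (z t)) (Icc 0 T) t) :
      ∀ t ∈ Ico 0 T, HasDerivWithinAt z (F (z t)) (Ici t) t := fun t ht =>
    (hz t (Ico_subset_Icc_self ht)).mono_of_mem_nhdsWithin
      (mem_of_superset (Icc_mem_nhdsGE ht.2) (Icc_subset_Icc_left ht.1))
  exact ODE_solution_unique_of_mem_Icc_right (v := fun _ => F)
    (s := fun _ => Metric.closedBall 0 R) (fun _ _ => hK)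
    (fun t ht => (hx t ht).continuousWithinAt) (right hx)
    (fun t ht => mem_closedBall_zero_iff.2 (hxR t (Ico_subset_Icc_self ht)))
    (fun t ht => (hy t ht).continuousWithinAt) (right hy)
    (fun t ht => mem_closedBall_zero_iff.2 (hyR t (Ico_subset_Icc_self ht))) h0

/-- The cutoff that is `1` on the ball of radius `R` and `0` outside the ball of radius `R + 1`. -/
def cutoff (R : ℝ) (x : W) : ℝ := max 0 (min 1 (R + 1 - ‖x‖))

omit [ProperSpace W] in
theorem locallyLipschitz_cutoff_smul {F : W → W} (hF : LocallyLipschitz F) (R : ℝ) :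
    LocallyLipschitz (fun x => cutoff R x • F x) := by
  have hc : LocallyLipschitz (cutoff (W := W) R) := by
    have : LocallyLipschitz fun x : W => ‖x‖ := lipschitzWith_one_norm.locallyLipschitz
    have h2 : LocallyLipschitz fun x : W => R + 1 - ‖x‖ := (LocallyLipschitz.const (R + 1)).sub this
    exact (h2.const_min 1).const_max 0
  intro x
  obtain ⟨K, t, ht, hK⟩ := hc.prodMk hF x
  obtain ⟨L, s, hs, hL⟩ := (contDiff_smul (𝕜 := ℝ) (F := W) (n := 1)).locallyLipschitz
    (cutoff R x, F x)
  exact ⟨L * K, t ∩ (fun x => (cutoff R x, F x)) ⁻¹' s,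
    inter_mem ht ((hc.continuous.prodMk hF.continuous).continuousAt hs),
    hL.comp (hK.mono inter_subset_left) fun y hy => hy.2⟩

/-- A locally Lipschitz vector field that vanishes outside a ball has solutions on `[0, T]`. -/
theorem exists_solution_Icc_of_vanish {F : W → W} (hF : LocallyLipschitz F) {R : ℝ}
    (hR : ∀ x, R < ‖x‖ → F x = 0) (x₀ : W) {T : ℝ} (hT : 0 ≤ T) :
    ∃ x : ℝ → W, x 0 = x₀ ∧ ∀ t ∈ Icc 0 T, HasDerivWithinAt x (F (x t)) (Icc 0 T) t := by
  obtain ⟨L, hL⟩ := (isCompact_closedBall (0 : W) R).exists_bound_of_continuousOn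
    hF.continuous.continuousOn
  have hL' : ∀ x, ‖F x‖ ≤ max L 0 := fun x => by
    by_cases h : R < ‖x‖
    · simp [hR x h]
    · exact (hL x (mem_closedBall_zero_iff.2 (not_lt.1 h))).trans (le_max_left _ _)
  obtain ⟨K, hK⟩ := (hF.locallyLipschitzOn
    (s := Metric.closedBall x₀ (max L 0 * T))).exists_lipschitzOnWith_of_compact
    (isCompact_closedBall _ _)
  -- The global speed bound makes the ball of radius speed times `T` large enough for the whole
  -- interval at once. The maximum with `0` covers an empty ball.
  have hpl : IsPicardLindelof (fun _ => F) (tmin := 0) (tmax := T) ⟨0, left_mem_Icc.2 hT⟩ x₀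
      ⟨max L 0 * T, by positivity⟩ 0 ⟨max L 0, by positivity⟩ K :=
    IsPicardLindelof.of_time_independent (fun x _ => hL' x) hK (by simp [hT]; exact le_rfl)
  exact hpl.exists_eq_forall_mem_Icc_hasDerivWithinAt₀

/-- A locally Lipschitz vector field with a Lyapunov function whose sublevel set is bounded has a
solution on `[0, ∞)`. -/
theorem exists_solution_of_lyapunov {F : W → W} (hF : LocallyLipschitz F) {V : W → ℝ}
    {V' : W → W →L[ℝ] ℝ} (hV : ∀ x, HasFDerivAt V (V' x) x) (hdec : ∀ x, V' x (F x) ≤ 0) (x₀ : W)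
    {R : ℝ} (hR : ∀ y, V y ≤ V x₀ → ‖y‖ ≤ R) :
    ∃ x : ℝ → W, x 0 = x₀ ∧ ∀ t ∈ Ici (0 : ℝ), HasDerivWithinAt x (F (x t)) (Ici 0) t := by
  -- The cutoff is nonnegative, so `V` still decreases along the truncated field. The solution then
  -- stays in the ball where the cutoff is `1`, and it solves the original equation.
  have hsol (n : ℕ) : ∃ x : ℝ → W, x 0 = x₀ ∧ (∀ t ∈ Icc (0 : ℝ) n, ‖x t‖ ≤ R) ∧
      ∀ t ∈ Icc (0 : ℝ) n, HasDerivWithinAt x (F (x t)) (Icc 0 (n : ℝ)) t := by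
    obtain ⟨x, hx0, hx⟩ := exists_solution_Icc_of_vanish (locallyLipschitz_cutoff_smul hF R)
      (R := R + 1) (fun x hx => by
        have : cutoff R x = 0 := max_eq_left ((min_le_right _ _).trans (by linarith))
        simp [this]) x₀ (Nat.cast_nonneg n)
    have hanti : AntitoneOn (fun t => V (x t)) (Icc (0 : ℝ) n) :=
      antitoneOn_of_hasDerivWithinAt (convex_Icc _ _)
        (fun t ht => (hV (x t)).comp_hasDerivWithinAt t (hx t ht)) fun t ht => by
          rw [map_smul, smul_eq_mul]
          exact mul_nonpos_of_nonneg_of_nonpos (le_max_left _ _) (hdec _)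
    have hbd : ∀ t ∈ Icc (0 : ℝ) n, ‖x t‖ ≤ R := fun t ht => hR _ <| by
      simpa [hx0] using hanti (left_mem_Icc.2 (Nat.cast_nonneg n)) ht ht.1
    refine ⟨x, hx0, hbd, fun t ht => ?_⟩
    have h1 : cutoff R (x t) = 1 := by
      have := hbd t ht
      rw [cutoff, min_eq_left (by linarith), max_eq_right zero_le_one]
    simpa [h1] using hx t ht
  choose x hx0 hxR hx using hsol
  have hagree {m n : ℕ} (hmn : m ≤ n) : EqOn (x m) (x n) (Icc (0 : ℝ) m) := by
    have hsub : Icc (0 : ℝ) m ⊆ Icc (0 : ℝ) n := Icc_subset_Icc_right (Nat.cast_le.2 hmn)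
    exact eqOn_of_solutions hF (hx m) (fun t ht => (hx n t (hsub ht)).mono hsub) (hxR m)
      (fun t ht => hxR n t (hsub ht)) ((hx0 m).trans (hx0 n).symm)
  -- The `+ 1` puts `t` strictly before the end of the interval used, so the derivative is also
  -- controlled to the right of `t`.
  refine ⟨fun t => x (⌊t⌋₊ + 1) t, hx0 _, fun t ht => ?_⟩
  set N := ⌊t⌋₊ + 1 with hN
  have htN : t < N := by simpa [hN] using Nat.lt_floor_add_one t
  have hmem : Icc (0 : ℝ) N ∈ 𝓝[Ici 0] t :=
    mem_of_superset (inter_mem_nhdsWithin _ (Iio_mem_nhds htN)) fun s hs => ⟨hs.1, hs.2.le⟩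
  refine ((hx N t ⟨ht, htN.le⟩).mono_of_mem_nhdsWithin hmem).congr_of_eventuallyEq ?_ rfl
  filter_upwards [inter_mem_nhdsWithin (Ici 0) (Iio_mem_nhds htN)] with s hs
  have hs1 : ⌊s⌋₊ + 1 ≤ N := (Nat.floor_lt hs.1).2 hs.2
  exact hagree hs1 ⟨hs.1, by simpa using (Nat.lt_floor_add_one s).le⟩

end ODE

/-! ### Matrices acting on Euclidean space, coercivity, projection on a half-space -/

section MatVec

variable {ι κ l : Type} [Fintype ι] [Fintype κ] [Fintype l]

/-- Matrix times vector as a continuous linear map. -/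
def matVecCLM (A : Matrix ι κ ℝ) : Vec κ →L[ℝ] Vec ι :=
  LinearMap.toContinuousLinearMap
    { toFun := matVec A
      map_add' := fun x y => by simp [matVec, Matrix.mulVec_add]
      map_smul' := fun c x => by simp [matVec, Matrix.mulVec_smul] }

theorem matVecCLM_apply (A : Matrix ι κ ℝ) (w : Vec κ) : matVecCLM A w = matVec A w := rfl

theorem matVec_add (A : Matrix ι κ ℝ) (w z : Vec κ) :
    matVec A (w + z) = matVec A w + matVec A z := (matVecCLM A).map_add w z

theorem matVec_sub (A : Matrix ι κ ℝ) (w z : Vec κ) :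
    matVec A (w - z) = matVec A w - matVec A z := (matVecCLM A).map_sub w z

theorem matVec_neg (A : Matrix ι κ ℝ) (w : Vec κ) :
    matVec A (-w) = -matVec A w := (matVecCLM A).map_neg w

theorem matVec_smul (A : Matrix ι κ ℝ) (c : ℝ) (w : Vec κ) :
    matVec A (c • w) = c • matVec A w := (matVecCLM A).map_smul c w

theorem matVec_zero (A : Matrix ι κ ℝ) : matVec A 0 = 0 := (matVecCLM A).map_zero

theorem zero_matVec (w : Vec κ) : matVec (0 : Matrix ι κ ℝ) w = 0 := by
  simp [matVec]

theorem one_matVec [DecidableEq κ] (w : Vec κ) : matVec (1 : Matrix κ κ ℝ) w = w := by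
  simp [matVec]

theorem mul_matVec (A : Matrix ι κ ℝ) (B : Matrix κ l ℝ) (w : Vec l) :
    matVec (A * B) w = matVec A (matVec B w) := by
  simp [matVec, Matrix.mulVec_mulVec]

theorem inner_matVec_left (A : Matrix ι κ ℝ) (w : Vec κ) (z : Vec ι) :
    inner ℝ (matVec A w) z = inner ℝ w (matVec A.transpose z) := by
  simp only [EuclideanSpace.inner_eq_star_dotProduct, matVec, star_trivial]
  rw [Matrix.dotProduct_mulVec, Matrix.mulVec_transpose, dotProduct_comm]

theorem eq_zero_of_matVec_eq_zero {A : Matrix κ κ ℝ} (h : ∀ w, matVec A w = 0) : A = 0 := by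
  refine Matrix.mulVec_injective (funext fun w => ?_)
  simpa [matVec] using congrArg WithLp.ofLp (h (WithLp.toLp 2 w))

theorem weightedSq_pos {A : Matrix κ κ ℝ} (hA : A.PosDef) {w : Vec κ} (hw : w ≠ 0) :
    0 < weightedSq A w := by
  have h := hA.dotProduct_mulVec_pos (x := w.ofLp) (by simpa using hw)
  rw [weightedSq, real_inner_comm, EuclideanSpace.inner_eq_star_dotProduct]
  simpa [matVec] using h

theorem weightedSq_nonneg {A : Matrix κ κ ℝ} (hA : A.PosDef) (w : Vec κ) :
    0 ≤ weightedSq A w := by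
  rcases eq_or_ne w 0 with rfl | hw
  · simp [weightedSq]
  · exact (weightedSq_pos hA hw).le

theorem continuous_weightedSq (A : Matrix κ κ ℝ) : Continuous (weightedSq A) :=
  continuous_id.inner (matVecCLM A).continuous

/-- The constant is the minimum on the compact unit sphere, extended by homogeneity. The sphere is
empty when there are no coordinates. -/
theorem exists_coercive {A : Matrix κ κ ℝ} (hA : A.PosDef) :
    ∃ m > 0, ∀ w : Vec κ, m * ‖w‖ ^ 2 ≤ weightedSq A w := by
  rcases (Metric.sphere (0 : Vec κ) 1).eq_empty_or_nonempty with he | hne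
  · refine ⟨1, one_pos, fun w => ?_⟩
    rcases eq_or_ne w 0 with rfl | hw
    · simp [weightedSq]
    · exfalso
      have : ‖w‖⁻¹ • w ∈ Metric.sphere (0 : Vec κ) 1 := by
        simp [norm_smul, norm_ne_zero_iff.2 hw]
      simp [he] at this
  · obtain ⟨z, hz, hmin⟩ := (isCompact_sphere (0 : Vec κ) 1).exists_isMinOn hne
      (continuous_weightedSq A).continuousOn
    have hz0 : z ≠ 0 := by
      rintro rfl
      simp at hz
    refine ⟨weightedSq A z, weightedSq_pos hA hz0, fun w => ?_⟩
    rcases eq_or_ne w 0 with rfl | hw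
    · simp [weightedSq]
    · have hn : ‖w‖ ≠ 0 := norm_ne_zero_iff.2 hw
      have h1 : weightedSq A z ≤ weightedSq A (‖w‖⁻¹ • w) :=
        hmin (by simp [norm_smul, hn])
      have h2 : weightedSq A (‖w‖⁻¹ • w) = (‖w‖ ^ 2)⁻¹ * weightedSq A w := by
        simp only [weightedSq, matVec_smul, inner_smul_left, inner_smul_right]
        simp
        ring
      have h3 : 0 < ‖w‖ ^ 2 := by positivity
      rw [h2] at h1
      calc weightedSq A z * ‖w‖ ^ 2 ≤ (‖w‖ ^ 2)⁻¹ * weightedSq A w * ‖w‖ ^ 2 := by gcongr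
        _ = weightedSq A w := by field_simp

theorem det_ne_zero_of_weightedSq_pos [DecidableEq κ] {A : Matrix κ κ ℝ}
    (h : ∀ w : Vec κ, w ≠ 0 → 0 < weightedSq A w) : A.det ≠ 0 := by
  intro hdet
  obtain ⟨w, hw, hAw⟩ := Matrix.exists_mulVec_eq_zero_iff.2 hdet
  have := h (WithLp.toLp 2 w) (by simpa using hw)
  simp [weightedSq, matVec, hAw] at this

/-- The point of least norm in a half-space. -/
theorem halfspace_projection {a : Vec κ} {β : ℝ} (h : a = 0 → 0 ≤ β) :
    0 ≤ β + inner ℝ a ((max 0 (-β) / ‖a‖ ^ 2) • a) ∧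
      ∀ w, 0 ≤ β + inner ℝ a w →
        ‖(max 0 (-β) / ‖a‖ ^ 2) • a‖ ^ 2 + ‖w - (max 0 (-β) / ‖a‖ ^ 2) • a‖ ^ 2 ≤ ‖w‖ ^ 2 := by
  rcases le_or_gt 0 β with hβ | hβ
  · simp [hβ]
  · have ha : ‖a‖ ^ 2 ≠ 0 := by
      have : a ≠ 0 := fun h0 => absurd (h h0) hβ.not_ge
      positivity
    rw [max_eq_right (neg_nonneg.2 hβ.le)]
    set s := -β / ‖a‖ ^ 2 with hs
    have hs0 : 0 ≤ s := div_nonneg (neg_nonneg.2 hβ.le) (sq_nonneg _)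
    have hsa : s * ‖a‖ ^ 2 = -β := div_mul_cancel₀ _ ha
    have h1 : inner ℝ a (s • a) = -β := by
      rw [inner_smul_right, real_inner_self_eq_norm_sq, hsa]
    refine ⟨by rw [h1]; simp, fun w hw => ?_⟩
    rw [norm_sub_sq_real, inner_smul_right, norm_smul, mul_pow, Real.norm_eq_abs, sq_abs,
      real_inner_comm]
    -- The left side of the claim exceeds the right by `2s(-β - ⟨a, w⟩)`, which is nonpositive by
    -- feasibility. This excess form yields minimality and uniqueness together.
    have : s ^ 2 * ‖a‖ ^ 2 = s * -β := by rw [← hsa]; ring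
    rw [this]
    nlinarith

end MatVec

/-! ### States, gradients and coercivity of the energy -/

section Mechanical

variable {n : ℕ}

/-- The state with the given position and velocity. -/
def mkState (q v : Vec (Fin n)) : MechState n := WithLp.toLp 2 (Sum.elim q.ofLp v.ofLp)

@[simp] theorem pos_mkState (q v : Vec (Fin n)) : pos (mkState q v) = q := rfl

@[simp] theorem vel_mkState (q v : Vec (Fin n)) : vel (mkState q v) = v := rfl

@[simp] theorem mkState_pos_vel (x : MechState n) : mkState (pos x) (vel x) = x := by
  ext i
  cases i <;> rfl

/-- The position as a continuous linear map. -/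
def posCLM : MechState n →L[ℝ] Vec (Fin n) :=
  LinearMap.toContinuousLinearMap
    { toFun := pos, map_add' := fun _ _ => rfl, map_smul' := fun _ _ => rfl }

/-- The velocity as a continuous linear map. -/
def velCLM : MechState n →L[ℝ] Vec (Fin n) :=
  LinearMap.toContinuousLinearMap
    { toFun := vel, map_add' := fun _ _ => rfl, map_smul' := fun _ _ => rfl }

theorem posCLM_apply (x : MechState n) : posCLM x = pos x := rfl

theorem velCLM_apply (x : MechState n) : velCLM x = vel x := rfl

/-- Pairing position and velocity as a continuous linear map. -/
def mkStateCLM : Vec (Fin n) × Vec (Fin n) →L[ℝ] MechState n :=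
  LinearMap.toContinuousLinearMap
    { toFun := fun p => mkState p.1 p.2
      map_add' := fun _ _ => by ext i; cases i <;> rfl
      map_smul' := fun _ _ => by ext i; cases i <;> rfl }

@[fun_prop] theorem contDiff_pos : ContDiff ℝ 1 (pos : MechState n → Vec (Fin n)) :=
  posCLM.contDiff

@[fun_prop] theorem contDiff_vel : ContDiff ℝ 1 (vel : MechState n → Vec (Fin n)) :=
  velCLM.contDiff

theorem contDiff_matVec {ι κ : Type} [Fintype ι] [Fintype κ] (A : Matrix ι κ ℝ) :
    ContDiff ℝ 1 (matVec A) := (matVecCLM A).contDiff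

theorem contDiff_weightedSq (A : Matrix (Fin n) (Fin n) ℝ) : ContDiff ℝ 1 (weightedSq A) :=
  contDiff_id.inner ℝ (contDiff_matVec A)

theorem inner_mkState (q v : Vec (Fin n)) (x : MechState n) :
    inner ℝ (mkState q v) x = inner ℝ q (pos x) + inner ℝ v (vel x) := by
  simp only [PiLp.inner_apply, Fintype.sum_sum_type]
  rfl

theorem norm_sq_eq_pos_vel (x : MechState n) : ‖x‖ ^ 2 = ‖pos x‖ ^ 2 + ‖vel x‖ ^ 2 := by
  simp only [← real_inner_self_eq_norm_sq]
  conv_lhs => rw [← mkState_pos_vel x]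
  rw [inner_mkState]
  rfl

theorem hasFDerivAt_weightedSq {A : Matrix (Fin n) (Fin n) ℝ} (hA : A.IsSymm) (w : Vec (Fin n)) :
    HasFDerivAt (fun w => 1 / 2 * weightedSq A w) (innerSL ℝ (matVec A w)) w := by
  have h := ((hasFDerivAt_id w).inner ℝ (matVecCLM A).hasFDerivAt).const_mul (1 / 2)
  refine h.congr_fderiv ?_
  ext z
  have h1 : inner ℝ (matVec A z) w = inner ℝ z (matVec A w) := by
    rw [inner_matVec_left, hA.eq]
  simp only [matVecCLM_apply, id_eq, smul_apply, ContinuousLinearMap.comp_apply,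
    ContinuousLinearMap.prod_apply, fderivInnerCLM_apply, smul_eq_mul, innerSL_apply_apply,
    ContinuousLinearMap.id_apply]
  rw [real_inner_comm (matVec A z) w, h1, real_inner_comm (matVec A w) z]
  ring

theorem hasGradientAt_quadratic {A B : Matrix (Fin n) (Fin n) ℝ} (hA : A.IsSymm) (hB : B.IsSymm)
    (x : MechState n) :
    HasGradientAt (fun x => 1 / 2 * (weightedSq A (pos x) + weightedSq B (vel x)))
      (mkState (matVec A (pos x)) (matVec B (vel x))) x := by
  have h := ((hasFDerivAt_weightedSq hA (pos x)).comp x posCLM.hasFDerivAt).add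
    ((hasFDerivAt_weightedSq hB (vel x)).comp x velCLM.hasFDerivAt)
  have h' := h.congr_of_eventuallyEq
    (f₁ := fun x => 1 / 2 * (weightedSq A (pos x) + weightedSq B (vel x)))
    (Eventually.of_forall fun y => mul_add _ _ _)
  refine h'.congr_fderiv ?_
  ext z
  simp only [add_apply, ContinuousLinearMap.comp_apply, innerSL_apply_apply,
    InnerProductSpace.toDual_apply_apply, inner_mkState]
  rfl

theorem mechLyapunov_eq (Kp : Matrix (Fin n) (Fin n) ℝ) : mechLyapunov Kp =
    fun x => 1 / 2 * (weightedSq Kp (pos x) + weightedSq 1 (vel x)) := by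
  funext x
  rw [mechLyapunov, weightedSq, weightedSq, one_matVec]

theorem hasGradientAt_mechLyapunov {Kp : Matrix (Fin n) (Fin n) ℝ} (hKp : Kp.PosDef)
    (x : MechState n) :
    HasGradientAt (mechLyapunov Kp) (mkState (matVec Kp (pos x)) (vel x)) x := by
  have h := hasGradientAt_quadratic (A := Kp) (B := 1)
    (by simpa using! hKp.isHermitian) Matrix.isSymm_one x
  rw [one_matVec] at h
  rwa [mechLyapunov_eq]

theorem hasGradientAt_mechBarrier (b : ℝ) {Pq Pv : Matrix (Fin n) (Fin n) ℝ} (hPq : Pq.IsSymm)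
    (hPv : Pv.PosDef) (x : MechState n) :
    HasGradientAt (mechBarrier b Pq Pv) (-mkState (matVec Pq (pos x)) (matVec Pv (vel x))) x := by
  have h := (hasGradientAt_quadratic hPq (by simpa using! hPv.isHermitian : Pv.IsSymm) x).const_sub b
  rw [HasGradientAt, HasGradientAtFilter, map_neg]
  exact h

theorem contDiff_mechLyapunov (Kp : Matrix (Fin n) (Fin n) ℝ) : ContDiff ℝ 1 (mechLyapunov Kp) :=
  contDiff_const.mul (((contDiff_weightedSq Kp).comp contDiff_pos).add
    (contDiff_vel.inner ℝ contDiff_vel))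

theorem mechLyapunov_zero (Kp : Matrix (Fin n) (Fin n) ℝ) : mechLyapunov Kp 0 = 0 := by
  have h1 : pos (0 : MechState n) = 0 := rfl
  have h2 : vel (0 : MechState n) = 0 := rfl
  simp [mechLyapunov, weightedSq, h1, h2]

theorem exists_mechLyapunov_coercive {Kp : Matrix (Fin n) (Fin n) ℝ} (hKp : Kp.PosDef) :
    ∃ m > 0, ∀ x : MechState n, m * ‖x‖ ^ 2 ≤ mechLyapunov Kp x := by
  obtain ⟨p, hp, h⟩ := exists_coercive hKp
  refine ⟨min p 1 / 2, by positivity, fun x => ?_⟩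
  rw [norm_sq_eq_pos_vel, mechLyapunov, real_inner_self_eq_norm_sq]
  have h1 := h (pos x)
  have h2 : min p 1 * ‖pos x‖ ^ 2 ≤ p * ‖pos x‖ ^ 2 := by gcongr; exact min_le_left _ _
  have h3 : min p 1 * ‖vel x‖ ^ 2 ≤ 1 * ‖vel x‖ ^ 2 := by gcongr; exact min_le_right _ _
  linarith

theorem mechLyapunov_nonneg {Kp : Matrix (Fin n) (Fin n) ℝ} (hKp : Kp.PosDef) (x : MechState n) :
    0 ≤ mechLyapunov Kp x := by
  obtain ⟨m, hm, h⟩ := exists_mechLyapunov_coercive hKp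
  exact le_trans (by positivity) (h x)

end Mechanical

/-! ### The damped linear system with state-dependent extra damping -/

section Damped

variable {n : ℕ}

/-- The vector field of `q'' = -K_p q - K_d q' - c P_v q'`. -/
def dampedField (Kp Kd Pv : Matrix (Fin n) (Fin n) ℝ) (c : MechState n → ℝ) (x : MechState n) :
    MechState n :=
  mkState (vel x) (-matVec Kp (pos x) + -matVec Kd (vel x) + -(c x • matVec Pv (vel x)))

variable {Kp Kd Pv : Matrix (Fin n) (Fin n) ℝ} {c : MechState n → ℝ}

theorem dampedField_zero : dampedField Kp Kd Pv c 0 = 0 := by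
  have h1 : pos (0 : MechState n) = 0 := rfl
  have h2 : vel (0 : MechState n) = 0 := rfl
  rw [dampedField, h1, h2]
  simp only [matVec_zero, smul_zero, neg_zero, add_zero]
  ext i
  cases i <;> rfl

/-- The power of the spring force cancels the change of potential energy; only the remaining
acceleration does work. -/
theorem inner_lyapunov_gradient (x : MechState n) (w : Vec (Fin n)) :
    inner ℝ (mkState (matVec Kp (pos x)) (vel x)) (mkState (vel x) (-matVec Kp (pos x) + w)) =
      inner ℝ (vel x) w := by
  rw [inner_mkState, pos_mkState, vel_mkState, inner_add_right, inner_neg_right,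
    real_inner_comm (vel x)]
  ring

theorem inner_lyapunov_gradient_dampedField (x : MechState n) :
    inner ℝ (mkState (matVec Kp (pos x)) (vel x)) (dampedField Kp Kd Pv c x) =
      -weightedSq Kd (vel x) - c x * weightedSq Pv (vel x) := by
  rw [dampedField, add_assoc, inner_lyapunov_gradient, inner_add_right, inner_neg_right,
    inner_neg_right, inner_smul_right]
  rfl

theorem lyapunov_decreasing_dampedField (hKd : Kd.PosDef) (hPv : Pv.PosDef)
    (hc : ∀ x, 0 ≤ c x) (x : MechState n) :
    inner ℝ (mkState (matVec Kp (pos x)) (vel x)) (dampedField Kp Kd Pv c x) ≤ 0 := by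
  rw [inner_lyapunov_gradient_dampedField]
  have := weightedSq_nonneg hKd (vel x)
  have := mul_nonneg (hc x) (weightedSq_nonneg hPv (vel x))
  linarith

theorem lyapunov_antitoneOn (hKp : Kp.PosDef) (hKd : Kd.PosDef) (hPv : Pv.PosDef)
    (hc : ∀ x, 0 ≤ c x) {I : Set ℝ} (hI : Convex ℝ I) {x : ℝ → MechState n}
    (hx : ∀ t ∈ I, HasDerivWithinAt x (dampedField Kp Kd Pv c (x t)) I t) :
    AntitoneOn (fun t => mechLyapunov Kp (x t)) I :=
  antitoneOn_of_hasDerivWithinAt hI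
    (fun t ht => (hasGradientAt_mechLyapunov hKp (x t)).hasFDerivAt.comp_hasDerivWithinAt t (hx t ht))
    fun t _ => lyapunov_decreasing_dampedField hKd hPv hc (x t)

theorem exists_norm_le_of_mechLyapunov_le (hKp : Kp.PosDef) (ν : ℝ) :
    ∃ R, ∀ y : MechState n, mechLyapunov Kp y ≤ ν → ‖y‖ ≤ R := by
  obtain ⟨m, hm, h⟩ := exists_mechLyapunov_coercive hKp
  refine ⟨√(ν / m), fun y hy => Real.le_sqrt_of_sq_le ?_⟩
  rw [le_div_iff₀ hm]
  linarith [h y]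

theorem exists_solution_dampedField (hKp : Kp.PosDef) (hKd : Kd.PosDef) (hPv : Pv.PosDef)
    (hc : ∀ x, 0 ≤ c x) (hF : LocallyLipschitz (dampedField Kp Kd Pv c)) (x₀ : MechState n) :
    ∃ x : ℝ → MechState n, x 0 = x₀ ∧
      ∀ t ∈ Ici (0 : ℝ), HasDerivWithinAt x (dampedField Kp Kd Pv c (x t)) (Ici 0) t := by
  obtain ⟨R, hR⟩ := exists_norm_le_of_mechLyapunov_le hKp (mechLyapunov Kp x₀)
  exact exists_solution_of_lyapunov hF
    (fun x => (hasGradientAt_mechLyapunov hKp x).hasFDerivAt)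
    (lyapunov_decreasing_dampedField hKd hPv hc) x₀ hR

/-- Decrease of the energy confines both solutions to one ball, where the field is Lipschitz. -/
theorem eqOn_of_solutions_dampedField (hKp : Kp.PosDef) (hKd : Kd.PosDef) (hPv : Pv.PosDef)
    (hc : ∀ x, 0 ≤ c x) (hF : LocallyLipschitz (dampedField Kp Kd Pv c)) {T : ℝ}
    {x y : ℝ → MechState n}
    (hx : ∀ t ∈ Ico 0 T, HasDerivWithinAt x (dampedField Kp Kd Pv c (x t)) (Ico 0 T) t)
    (hy : ∀ t ∈ Ico 0 T, HasDerivWithinAt y (dampedField Kp Kd Pv c (y t)) (Ico 0 T) t)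
    (h0 : x 0 = y 0) : EqOn x y (Ico 0 T) := by
  intro t ht
  obtain ⟨R, hR⟩ := exists_norm_le_of_mechLyapunov_le hKp (mechLyapunov Kp (x 0))
  have hsub : Icc 0 t ⊆ Ico 0 T := fun s hs => ⟨hs.1, hs.2.trans_lt ht.2⟩
  have h0T : (0 : ℝ) ∈ Ico 0 T := ⟨le_rfl, ht.1.trans_lt ht.2⟩
  have hxa := lyapunov_antitoneOn hKp hKd hPv hc (convex_Ico 0 T) hx
  have hya := lyapunov_antitoneOn hKp hKd hPv hc (convex_Ico 0 T) hy
  refine eqOn_of_solutions hF (fun s hs => (hx s (hsub hs)).mono hsub)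
    (fun s hs => (hy s (hsub hs)).mono hsub) (R := R)
    (fun s hs => hR _ (hxa h0T (hsub hs) hs.1)) (fun s hs => hR _ ?_) h0 (right_mem_Icc.2 ht.1)
  rw [h0]
  exact hya h0T (hsub hs) hs.1

/-- Here `r = ‖q‖` and `s = ‖v‖`. Young's inequality absorbs the cross term into half of `ε p r²`
and a multiple of `s²`; the bound `ε k ≤ d / 2` lets the damping pay for the latter. The bounds `ε ≤
p / 2` and `ε ≤ 1 / 2` keep the modified energy coercive. -/
theorem exists_strictification_constants {d p B : ℝ} (hd : 0 < d) (hp : 0 < p) :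
    ∃ ε a m : ℝ, 0 < ε ∧ ε ≤ 1 ∧ 0 < a ∧ 0 < m ∧ ∀ r s : ℝ,
      -(d * s ^ 2) + ε * s ^ 2 - ε * (p * r ^ 2) + ε * (B * (r * s)) ≤ -(a * (r ^ 2 + s ^ 2)) ∧
      m * (r ^ 2 + s ^ 2) ≤ 1 / 2 * (p * r ^ 2 + s ^ 2) - ε * (r * s) := by
  set k := 1 + B ^ 2 / (2 * p) with hk
  have hk0 : 0 < k := by positivity
  set ε := min (d / (2 * k)) (min (p / 2) (1 / 2)) with hε
  have hε0 : 0 < ε := by positivity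
  have h1 : ε * k ≤ d / 2 := by
    have : ε * k ≤ d / (2 * k) * k := by gcongr; exact min_le_left _ _
    have h2 : d / (2 * k) * k = d / 2 := by field_simp
    linarith
  have h2 : ε ≤ p / 2 := (min_le_right _ _).trans (min_le_left _ _)
  have h3 : ε ≤ 1 / 2 := (min_le_right _ _).trans (min_le_right _ _)
  refine ⟨ε, min (d / 2) (ε * p / 2), min p 1 / 4, hε0, by linarith, by positivity, by positivity,
    fun r s => ⟨?_, ?_⟩⟩
  · have e1 : B * (r * s) ≤ p / 2 * r ^ 2 + B ^ 2 / (2 * p) * s ^ 2 := by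
      have : p / 2 * r ^ 2 + B ^ 2 / (2 * p) * s ^ 2 - B * (r * s) =
          (p * r - B * s) ^ 2 / (2 * p) := by field_simp; ring
      have h4 : 0 ≤ (p * r - B * s) ^ 2 / (2 * p) := by positivity
      linarith
    have e2 : ε * (B * (r * s)) ≤ ε * (p / 2 * r ^ 2 + B ^ 2 / (2 * p) * s ^ 2) := by gcongr
    have e3 : ε * k * s ^ 2 ≤ d / 2 * s ^ 2 := by gcongr
    have e4 : min (d / 2) (ε * p / 2) * s ^ 2 ≤ d / 2 * s ^ 2 := by gcongr; exact min_le_left _ _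
    have e5 : min (d / 2) (ε * p / 2) * r ^ 2 ≤ ε * p / 2 * r ^ 2 := by
      gcongr; exact min_le_right _ _
    have e6 : ε * k * s ^ 2 = ε * s ^ 2 + ε * (B ^ 2 / (2 * p) * s ^ 2) := by rw [hk]; ring
    linarith
  · have e1 : ε * (r * s) ≤ ε * (1 / 2 * r ^ 2 + 1 / 2 * s ^ 2) := by
      gcongr
      nlinarith [sq_nonneg (r - s)]
    have e2 : ε * r ^ 2 ≤ p / 2 * r ^ 2 := by gcongr
    have e3 : ε * s ^ 2 ≤ 1 / 2 * s ^ 2 := by gcongr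
    have e4 : min p 1 * r ^ 2 ≤ p * r ^ 2 := by gcongr; exact min_le_left _ _
    have e5 : min p 1 * s ^ 2 ≤ 1 * s ^ 2 := by gcongr; exact min_le_right _ _
    linarith

/-- A curve with a strict quadratic Lyapunov function tends to the origin. -/
theorem tendsto_zero_of_strict_lyapunov {W : Type*} [NormedAddCommGroup W] {x : ℝ → W}
    {L L' : ℝ → ℝ} {a m U : ℝ} (ha : 0 < a) (hm : 0 < m) (hU : 0 < U)
    (hL : ∀ t ∈ Ici (0 : ℝ), HasDerivWithinAt L (L' t) (Ici 0) t)
    (hL' : ∀ t ∈ Ici (0 : ℝ), L' t ≤ -(a * ‖x t‖ ^ 2))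
    (hlow : ∀ t ∈ Ici (0 : ℝ), m * ‖x t‖ ^ 2 ≤ L t) (hup : ∀ t ∈ Ici (0 : ℝ), L t ≤ U * ‖x t‖ ^ 2) :
    Tendsto x atTop (𝓝 0) := by
  -- The upper bound on `L` turns the decay into `L' ≤ -(a / U) L`, so `L` decays exponentially.
  have hanti : AntitoneOn (fun t => Real.exp (a / U * t) * L t) (Ici 0) := by
    refine antitoneOn_of_hasDerivWithinAt (convex_Ici 0)
      (y' := fun t => Real.exp (a / U * t) * (a / U) * L t + Real.exp (a / U * t) * L' t)
      (fun t ht => ?_) fun t ht => ?_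
    · have h1 : HasDerivAt (fun t => Real.exp (a / U * t)) (Real.exp (a / U * t) * (a / U)) t := by
        simpa using ((hasDerivAt_id t).const_mul (a / U)).exp
      exact h1.hasDerivWithinAt.mul (hL t ht)
    · have h1 : a / U * L t ≤ a / U * (U * ‖x t‖ ^ 2) := by gcongr; exact hup t ht
      have h2 : a / U * (U * ‖x t‖ ^ 2) = a * ‖x t‖ ^ 2 := by field_simp
      have h3 : a / U * L t + L' t ≤ 0 := by linarith [hL' t ht]
      have h4 := mul_nonpos_of_nonneg_of_nonpos (Real.exp_pos (a / U * t)).le h3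
      linarith
  have hexp : Tendsto (fun t => L 0 / m * Real.exp (-(a / U * t))) atTop (𝓝 0) := by
    have h1 : Tendsto (fun t : ℝ => a / U * t) atTop atTop :=
      tendsto_id.const_mul_atTop (by positivity)
    simpa using (Real.tendsto_exp_neg_atTop_nhds_zero.comp h1).const_mul (L 0 / m)
  have hsq : Tendsto (fun t => ‖x t‖ ^ 2) atTop (𝓝 0) := by
    refine squeeze_zero' (Eventually.of_forall fun t => sq_nonneg _) ?_ hexp
    filter_upwards [eventually_ge_atTop 0] with t ht
    have h1 : Real.exp (a / U * t) * L t ≤ L 0 := by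
      simpa using hanti (mem_Ici.2 le_rfl) ht ht
    have h2 : L t ≤ L 0 * Real.exp (-(a / U * t)) := by
      rw [Real.exp_neg, ← div_eq_mul_inv, le_div_iff₀ (Real.exp_pos _)]
      linarith
    have h3 := hlow t ht
    rw [div_mul_eq_mul_div, le_div_iff₀ hm]
    linarith
  refine tendsto_zero_iff_norm_tendsto_zero.2 ?_
  simpa [Real.sqrt_sq] using hsq.sqrt

theorem inner_matVec_le {ι κ : Type} [Fintype ι] [Fintype κ] (A : Matrix ι κ ℝ) (w : Vec ι)
    (z : Vec κ) : |inner ℝ w (matVec A z)| ≤ ‖matVecCLM A‖ * (‖w‖ * ‖z‖) := by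
  refine (abs_real_inner_le_norm _ _).trans ?_
  have := (matVecCLM A).le_opNorm z
  calc ‖w‖ * ‖matVec A z‖ ≤ ‖w‖ * (‖matVecCLM A‖ * ‖z‖) := by gcongr; exact this
    _ = _ := by ring

/-- Every solution of the damped system converges to the origin. -/
theorem tendsto_zero_of_dampedField (hKp : Kp.PosDef) (hKd : Kd.PosDef) (hPv : Pv.PosDef)
    (hc : ∀ x, 0 ≤ c x) (hcont : Continuous c) {x : ℝ → MechState n}
    (hx : ∀ t ∈ Ici (0 : ℝ), HasDerivWithinAt x (dampedField Kp Kd Pv c (x t)) (Ici 0) t) :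
    Tendsto x atTop (𝓝 0) := by
  obtain ⟨R, hR⟩ := exists_norm_le_of_mechLyapunov_le hKp (mechLyapunov Kp (x 0))
  have hxR : ∀ t ∈ Ici (0 : ℝ), ‖x t‖ ≤ R := fun t ht => hR _ <|
    lyapunov_antitoneOn hKp hKd hPv hc (convex_Ici 0) hx (mem_Ici.2 le_rfl) ht ht
  -- The gain need not be bounded on the whole space; it is bounded along a trajectory, which the
  -- energy keeps in a compact ball.
  obtain ⟨γ, hγ⟩ := (isCompact_closedBall (0 : MechState n) R).exists_bound_of_continuousOn
    hcont.continuousOn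
  have hcγ : ∀ t ∈ Ici (0 : ℝ), c (x t) ≤ γ := fun t ht =>
    (le_abs_self _).trans (hγ _ (mem_closedBall_zero_iff.2 (hxR t ht)))
  have hγ0 : 0 ≤ γ := (hc _).trans (hcγ 0 (mem_Ici.2 le_rfl))
  obtain ⟨p, hp, hKp'⟩ := exists_coercive hKp
  obtain ⟨d, hd, hKd'⟩ := exists_coercive hKd
  obtain ⟨ε, a, m, hε, hε1, ha, hm, hconst⟩ := exists_strictification_constants hd hp
    (B := ‖matVecCLM Kd‖ + γ * ‖matVecCLM Pv‖)
  -- The energy alone decays only through the velocity. The term `ε qᵀv` contributes `-ε qᵀK_p q`,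
  -- the missing decay in the position.
  refine tendsto_zero_of_strict_lyapunov ha hm (U := ‖matVecCLM Kp‖ + 1) (by positivity)
    (L := fun t => mechLyapunov Kp (x t) + ε * inner ℝ (pos (x t)) (vel (x t)))
    (fun t ht => ((hasGradientAt_mechLyapunov hKp (x t)).hasFDerivAt.comp_hasDerivWithinAt t
      (hx t ht)).add (((posCLM.hasFDerivAt.comp_hasDerivWithinAt t (hx t ht)).inner ℝ
        (velCLM.hasFDerivAt.comp_hasDerivWithinAt t (hx t ht))).const_mul ε))
    (fun t ht => ?_) (fun t ht => ?_) fun t ht => ?_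
  · simp only [Function.comp_apply, InnerProductSpace.toDual_apply_apply, posCLM_apply,
      velCLM_apply]
    rw [inner_lyapunov_gradient_dampedField, norm_sq_eq_pos_vel]
    simp only [dampedField, pos_mkState, vel_mkState, inner_add_right, inner_neg_right,
      inner_smul_right, real_inner_self_eq_norm_sq]
    set q := pos (x t)
    set v := vel (x t)
    have h1 := (hconst ‖q‖ ‖v‖).1
    have h2 := hKd' v
    have h3 : p * ‖q‖ ^ 2 ≤ inner ℝ q (matVec Kp q) := hKp' q
    have h4 := (neg_le_abs _).trans (inner_matVec_le Kd q v)
    have h5 := (neg_le_abs _).trans (inner_matVec_le Pv q v)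
    have h6 : c (x t) * -inner ℝ q (matVec Pv v) ≤ γ * ‖matVecCLM Pv‖ * (‖q‖ * ‖v‖) := by
      calc c (x t) * -inner ℝ q (matVec Pv v)
          ≤ c (x t) * (‖matVecCLM Pv‖ * (‖q‖ * ‖v‖)) :=
            mul_le_mul_of_nonneg_left h5 (hc _)
        _ ≤ γ * (‖matVecCLM Pv‖ * (‖q‖ * ‖v‖)) := by gcongr; exact hcγ t ht
        _ = _ := by ring
    have h7 := mul_nonneg (hc (x t)) (weightedSq_nonneg hPv v)
    have h8 : ε * (-inner ℝ q (matVec Kp q) + -inner ℝ q (matVec Kd v) +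
        -(c (x t) * inner ℝ q (matVec Pv v)) + ‖v‖ ^ 2) ≤
        ε * (-(p * ‖q‖ ^ 2) + (‖matVecCLM Kd‖ + γ * ‖matVecCLM Pv‖) * (‖q‖ * ‖v‖) + ‖v‖ ^ 2) := by
      apply mul_le_mul_of_nonneg_left _ hε.le
      linarith
    linarith
  · rw [norm_sq_eq_pos_vel]
    set q := pos (x t) with hq
    set v := vel (x t) with hv
    have h1 := (hconst ‖q‖ ‖v‖).2
    have h2 := hKp' q
    have h3 : ε * -inner ℝ q v ≤ ε * (‖q‖ * ‖v‖) :=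
      mul_le_mul_of_nonneg_left ((neg_le_abs _).trans (abs_real_inner_le_norm _ _)) hε.le
    rw [mechLyapunov, real_inner_self_eq_norm_sq, ← hq, ← hv]
    linarith
  · rw [norm_sq_eq_pos_vel]
    set q := pos (x t) with hq
    set v := vel (x t) with hv
    have h1 : weightedSq Kp q ≤ ‖matVecCLM Kp‖ * (‖q‖ * ‖q‖) :=
      (le_abs_self _).trans (inner_matVec_le Kp q q)
    have h2 : ε * inner ℝ q v ≤ 1 * (‖q‖ * ‖v‖) :=
      (mul_le_mul_of_nonneg_left (real_inner_le_norm _ _) hε.le).trans (by gcongr)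
    rw [mechLyapunov, real_inner_self_eq_norm_sq, ← hq, ← hv]
    nlinarith [sq_nonneg (‖q‖ - ‖v‖), norm_nonneg (matVecCLM Kp), sq_nonneg ‖v‖, sq_nonneg ‖q‖,
      mul_nonneg (norm_nonneg (matVecCLM Kp)) (sq_nonneg ‖v‖),
      mul_nonneg (norm_nonneg (matVecCLM Kp)) (sq_nonneg ‖q‖)]

/-- Small energy sublevel sets are invariant and lie in `Ω`, so solutions of the global damped field
that start near the origin never leave the region where the two fields agree. -/
theorem asymptoticallyStable_of_eqOn_dampedField (hKp : Kp.PosDef) (hKd : Kd.PosDef)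
    (hPv : Pv.PosDef) (hc : ∀ x, 0 ≤ c x) (hcont : Continuous c)
    (hF : LocallyLipschitz (dampedField Kp Kd Pv c)) {Ω : Set (MechState n)} (hΩ : Ω ∈ 𝓝 0)
    {G : MechState n → MechState n} (hG : EqOn G (dampedField Kp Kd Pv c) Ω) :
    AsymptoticallyStable Ω G where
  equilibrium := ⟨mem_of_mem_nhds hΩ, (hG (mem_of_mem_nhds hΩ)).trans dampedField_zero⟩
  stable := by
    intro ε hε
    obtain ⟨m, hm, hlow⟩ := exists_mechLyapunov_coercive hKp
    obtain ⟨r, hr, hrΩ⟩ := Metric.mem_nhds_iff.1 (inter_mem hΩ (Metric.ball_mem_nhds 0 hε))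
    have hball : ∀ y, mechLyapunov Kp y < m * r ^ 2 → y ∈ Ω ∧ ‖y‖ < ε := fun y hy => by
      have h1 : ‖y‖ < r := by
        have := hlow y
        exact lt_of_pow_lt_pow_left₀ 2 hr.le (lt_of_mul_lt_mul_left (this.trans_lt hy) hm.le)
      simpa using hrΩ (mem_ball_zero_iff.2 h1)
    have hV : ∀ᶠ y in 𝓝 0, mechLyapunov Kp y < m * r ^ 2 :=
      (contDiff_mechLyapunov Kp).continuous.continuousAt.eventually_lt_const
        (by rw [mechLyapunov_zero]; positivity)
    obtain ⟨δ, hδ, hδV⟩ := Metric.eventually_nhds_iff_ball.1 hV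
    refine ⟨δ, hδ, fun x₀ hx₀ => ?_⟩
    have hx₀V := hδV x₀ (mem_ball_zero_iff.2 hx₀)
    refine ⟨?_, fun T x hx hx0 t ht => ?_⟩
    · obtain ⟨x, hx0, hx⟩ := exists_solution_dampedField hKp hKd hPv hc hF x₀
      have hΩx : ∀ t ∈ Ici (0 : ℝ), x t ∈ Ω := fun t ht => (hball _ <| by
        have := lyapunov_antitoneOn hKp hKd hPv hc (convex_Ici 0) hx (mem_Ici.2 le_rfl) ht ht
        rw [← hx0] at hx₀V
        exact this.trans_lt hx₀V).1
      exact ⟨x, fun t ht => ⟨hΩx t ht, by rw [hG (hΩx t ht)]; exact hx t ht⟩, hx0⟩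
    · have hx' : ∀ t ∈ Ico 0 T, HasDerivWithinAt x (dampedField Kp Kd Pv c (x t)) (Ico 0 T) t :=
        fun t ht => by rw [← hG (hx t ht).1]; exact (hx t ht).2
      have := lyapunov_antitoneOn hKp hKd hPv hc (convex_Ico 0 T) hx'
        ⟨le_rfl, ht.1.trans_lt ht.2⟩ ht ht.1
      rw [← hx0] at hx₀V
      exact (hball _ (this.trans_lt hx₀V)).2
  -- The radius is arbitrary: every solution in `Ω` for all positive times converges.
  attractive := ⟨1, one_pos, fun x hx _ => tendsto_zero_of_dampedField hKp hKd hPv hc hcont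
    fun t ht => by rw [← hG (hx t ht).1]; exact (hx t ht).2⟩

end Damped

/-! ### Feedback linearization and the explicit solution of the quadratic program -/

section ClosedLoop

variable {n : ℕ} {M : Vec (Fin n) → Matrix (Fin n) (Fin n) ℝ}
  {C : Vec (Fin n) → Vec (Fin n) → Matrix (Fin n) (Fin n) ℝ} {τ : Vec (Fin n) → Vec (Fin n)}
  {Kp Kd Pq Pv : Matrix (Fin n) (Fin n) ℝ} {b : ℝ} {α : ℝ → ℝ} {x : MechState n}

theorem mechDrift_eq : mechDrift M C τ x = mkState (vel x)
    (matVec (M (pos x))⁻¹ (-matVec (C (pos x) (vel x)) (vel x) - τ (pos x))) := rfl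

theorem matVec_mechInput (u : Vec (Fin n)) :
    matVec (mechInput M x) u = mkState 0 (matVec (M (pos x))⁻¹ u) := by
  ext i
  cases i <;> simp [matVec, mechInput, mkState, Matrix.fromRows_mulVec]

theorem inv_matVec_matVec {A : Matrix (Fin n) (Fin n) ℝ} (hA : A.det ≠ 0) (w : Vec (Fin n)) :
    matVec A⁻¹ (matVec A w) = w := by
  rw [← mul_matVec, Matrix.nonsing_inv_mul _ (isUnit_iff_ne_zero.2 hA), one_matVec]

theorem matVec_inv_matVec {A : Matrix (Fin n) (Fin n) ℝ} (hA : A.det ≠ 0) (w : Vec (Fin n)) :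
    matVec A (matVec A⁻¹ w) = w := by
  rw [← mul_matVec, Matrix.mul_nonsing_inv _ (isUnit_iff_ne_zero.2 hA), one_matVec]

/-- Feedback linearization: a torque deviates from the computed torque by an acceleration. -/
theorem mechDrift_add_mechInput (hx : (M (pos x)).det ≠ 0) (μ u : Vec (Fin n)) :
    mechDrift M C τ x + matVec (mechInput M x) u = mkState (vel x) (-matVec Kp (pos x) +
      (μ + matVec (M (pos x))⁻¹ (u - torqueWithInput M C τ Kp x μ))) := by
  have h : matVec (M (pos x))⁻¹ (u - torqueWithInput M C τ Kp x μ) =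
      matVec (M (pos x))⁻¹ (-matVec (C (pos x) (vel x)) (vel x) - τ (pos x)) +
        matVec (M (pos x))⁻¹ u - (-matVec Kp (pos x) + μ) := by
    rw [← inv_matVec_matVec hx (-matVec Kp (pos x) + μ), ← matVec_add, ← matVec_sub,
      torqueWithInput]
    congr 1
    abel
  rw [h, matVec_mechInput, mechDrift_eq]
  have hadd (q v q' v' : Vec (Fin n)) : mkState q v + mkState q' v' = mkState (q + q') (v + v') :=
    (mkStateCLM.map_add (q, v) (q', v')).symm
  rw [hadd, add_zero]
  congr 1
  abel

theorem lieF_add_lieG {ι κ : Type} [Fintype ι] [Fintype κ] (f : Vec ι → Vec ι)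
    (g : Vec ι → Matrix ι κ ℝ) (h : Vec ι → ℝ) (x : Vec ι) (u : Vec κ) :
    lieF f h x + inner ℝ (lieG g h x) u = inner ℝ (gradient h x) (f x + matVec (g x) u) := by
  rw [lieF, lieG, inner_matVec_left, Matrix.transpose_transpose, inner_add_right]

theorem lieG_mechBarrier (hPq : Pq.IsSymm) (hPv : Pv.PosDef) :
    lieG (mechInput M) (mechBarrier b Pq Pv) x =
      -matVec (M (pos x))⁻¹.transpose (matVec Pv (vel x)) := by
  refine ext_inner_right ℝ fun u => ?_
  rw [lieG, (hasGradientAt_mechBarrier b hPq hPv x).gradient, inner_matVec_left,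
    Matrix.transpose_transpose, matVec_mechInput, inner_neg_left, inner_mkState, inner_neg_left,
    inner_matVec_left (M (pos x))⁻¹.transpose, Matrix.transpose_transpose]
  simp

/-- The slack of the barrier condition under the computed torque with the input term `μ`. -/
def slack (Kp Pq Pv : Matrix (Fin n) (Fin n) ℝ) (b : ℝ) (α : ℝ → ℝ) (μ : Vec (Fin n))
    (x : MechState n) : ℝ :=
  -inner ℝ (matVec Pq (pos x)) (vel x) - inner ℝ (matVec Pv (vel x)) (-matVec Kp (pos x) + μ) +
    α (mechBarrier b Pq Pv x)

/-- The gain of the additional damping by which the quadratic program restores the barrier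
condition. -/
def gain (Kp Pq Pv : Matrix (Fin n) (Fin n) ℝ) (b : ℝ) (α : ℝ → ℝ) (μ : Vec (Fin n))
    (x : MechState n) : ℝ :=
  -- At rest the denominator is zero and the quotient is `0` by convention.
  max 0 (-slack Kp Pq Pv b α μ x) / ‖matVec Pv (vel x)‖ ^ 2

theorem gain_nonneg (μ : Vec (Fin n)) (x : MechState n) : 0 ≤ gain Kp Pq Pv b α μ x :=
  div_nonneg (le_max_left _ _) (sq_nonneg _)

theorem barrier_condition_eq (hPq : Pq.IsSymm) (hPv : Pv.PosDef) (μ w : Vec (Fin n)) :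
    inner ℝ (gradient (mechBarrier b Pq Pv) x)
      (mkState (vel x) (-matVec Kp (pos x) + (μ + w))) + α (mechBarrier b Pq Pv x) =
        slack Kp Pq Pv b α μ x + inner ℝ (-matVec Pv (vel x)) w := by
  rw [(hasGradientAt_mechBarrier b hPq hPv x).gradient, inner_neg_left, inner_mkState, slack]
  simp only [pos_mkState, vel_mkState, inner_add_right, inner_neg_right, inner_neg_left]
  ring

theorem qpFeasible_iff (hPq : Pq.IsSymm) (hPv : Pv.PosDef) (hx : (M (pos x)).det ≠ 0)
    (μ u : Vec (Fin n)) :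
    QPFeasible (mechDrift M C τ) (mechInput M) (mechBarrier b Pq Pv) α x u ↔
      0 ≤ slack Kp Pq Pv b α μ x + inner ℝ (-matVec Pv (vel x))
        (matVec (M (pos x))⁻¹ (u - torqueWithInput M C τ Kp x μ)) := by
  rw [QPFeasible, lieF_add_lieG, mechDrift_add_mechInput hx μ, ← barrier_condition_eq hPq hPv,
    ge_iff_le, neg_le_iff_add_nonneg]

/-- Where the normal of the half-space vanishes, the barrier expression does not depend on the
input, so its supremum is the slack itself. This is feasibility in the degenerate case. -/
theorem slack_nonneg_of_sup (hPq : Pq.IsSymm) (hPv : Pv.PosDef) (hx : (M (pos x)).det ≠ 0)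
    (hsup : (0 : EReal) ≤ ⨆ u : Vec (Fin n), ((lieF (mechDrift M C τ) (mechBarrier b Pq Pv) x +
      inner ℝ (lieG (mechInput M) (mechBarrier b Pq Pv) x) u + α (mechBarrier b Pq Pv x) : ℝ) :
        EReal)) (μ : Vec (Fin n)) (h0 : -matVec Pv (vel x) = 0) :
    0 ≤ slack Kp Pq Pv b α μ x := by
  have h (u : Vec (Fin n)) : lieF (mechDrift M C τ) (mechBarrier b Pq Pv) x +
      inner ℝ (lieG (mechInput M) (mechBarrier b Pq Pv) x) u + α (mechBarrier b Pq Pv x) =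
        slack Kp Pq Pv b α μ x := by
    rw [lieF_add_lieG, mechDrift_add_mechInput (Kp := Kp) hx μ, barrier_condition_eq hPq hPv, h0,
      inner_zero_left, add_zero]
  simpa [h] using hsup

theorem weightedSq_mechWeight (z : Vec (Fin n)) :
    weightedSq (mechWeight M x) z = ‖matVec (M (pos x))⁻¹ z‖ ^ 2 := by
  rw [weightedSq, mechWeight, mul_matVec, real_inner_comm, inner_matVec_left,
    Matrix.transpose_transpose, real_inner_self_eq_norm_sq]

/-- In the acceleration variable the minimizer is the point of least norm in a half-space; since `M`
is invertible, this determines the torque. -/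
theorem isQPSolution_iff (hPq : Pq.IsSymm) (hPv : Pv.PosDef) (hx : (M (pos x)).det ≠ 0)
    {μ : Vec (Fin n)} (hs : -matVec Pv (vel x) = 0 → 0 ≤ slack Kp Pq Pv b α μ x)
    (u : Vec (Fin n)) :
    IsQPSolution (mechDrift M C τ) (mechInput M) (mechBarrier b Pq Pv) α (mechWeight M)
      (torqueWithInput M C τ Kp x μ) x u ↔
    u = torqueWithInput M C τ Kp x μ +
      matVec (M (pos x)) (-(gain Kp Pq Pv b α μ x • matVec Pv (vel x))) := by
  have hw : -(gain Kp Pq Pv b α μ x • matVec Pv (vel x)) =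
      (max 0 (-slack Kp Pq Pv b α μ x) / ‖-matVec Pv (vel x)‖ ^ 2) • -matVec Pv (vel x) := by
    rw [norm_neg, smul_neg, gain]
  obtain ⟨h1, h2⟩ := halfspace_projection hs
  rw [← hw] at h1 h2
  set w := -(gain Kp Pq Pv b α μ x • matVec Pv (vel x))
  have hT : matVec (M (pos x))⁻¹ (torqueWithInput M C τ Kp x μ + matVec (M (pos x)) w -
      torqueWithInput M C τ Kp x μ) = w := by
    rw [add_sub_cancel_left, inv_matVec_matVec hx]
  simp only [IsQPSolution, qpFeasible_iff (Kp := Kp) hPq hPv hx μ, weightedSq_mechWeight]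
  constructor
  · rintro ⟨hu, hmin⟩
    have h3 := hmin _ (hT.symm ▸ h1)
    rw [hT] at h3
    have h4 := h2 _ hu
    have h5 : ‖matVec (M (pos x))⁻¹ (u - torqueWithInput M C τ Kp x μ) - w‖ ^ 2 = 0 :=
      le_antisymm (by linarith) (sq_nonneg _)
    rw [sq_eq_zero_iff, norm_eq_zero, sub_eq_zero] at h5
    rw [← h5, matVec_inv_matVec hx]
    abel
  · rintro rfl
    refine ⟨hT.symm ▸ h1, fun z hz => ?_⟩
    rw [hT]
    have := h2 _ hz
    have := sq_nonneg ‖matVec (M (pos x))⁻¹ (z - torqueWithInput M C τ Kp x μ) - w‖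
    linarith

/-- The dynamics under the solution of the quadratic program. -/
theorem dynamics_of_isQPSolution (hPq : Pq.IsSymm) (hPv : Pv.PosDef) (hx : (M (pos x)).det ≠ 0)
    {μ : Vec (Fin n)} (hs : -matVec Pv (vel x) = 0 → 0 ≤ slack Kp Pq Pv b α μ x)
    {u : Vec (Fin n)}
    (hu : IsQPSolution (mechDrift M C τ) (mechInput M) (mechBarrier b Pq Pv) α (mechWeight M)
      (torqueWithInput M C τ Kp x μ) x u) :
    mechDrift M C τ x + matVec (mechInput M x) u = mkState (vel x) (-matVec Kp (pos x) +
      (μ + -(gain Kp Pq Pv b α μ x • matVec Pv (vel x)))) := by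
  rw [mechDrift_add_mechInput hx μ, (isQPSolution_iff hPq hPv hx hs u).1 hu, add_sub_cancel_left,
    inv_matVec_matVec hx]

/-- The correction does the work `-c vᵀP_v v ≤ 0`, whatever the input term. -/
theorem dissipation_of_isQPSolution (hKp : Kp.PosDef) (hPq : Pq.IsSymm) (hPv : Pv.PosDef)
    (hx : (M (pos x)).det ≠ 0)
    {μ : Vec (Fin n)} (hs : -matVec Pv (vel x) = 0 → 0 ≤ slack Kp Pq Pv b α μ x)
    {u : Vec (Fin n)}
    (hu : IsQPSolution (mechDrift M C τ) (mechInput M) (mechBarrier b Pq Pv) α (mechWeight M)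
      (torqueWithInput M C τ Kp x μ) x u) :
    inner ℝ (gradient (mechLyapunov Kp) x) (mechDrift M C τ x + matVec (mechInput M x) u) ≤
      inner ℝ μ (vel x) := by
  rw [(hasGradientAt_mechLyapunov hKp x).gradient, dynamics_of_isQPSolution hPq hPv hx hs hu,
    inner_lyapunov_gradient, inner_add_right, inner_neg_right, inner_smul_right,
    real_inner_comm (vel x)]
  have := mul_nonneg (gain_nonneg (Kp := Kp) (Pq := Pq) (Pv := Pv) (b := b) (α := α) μ x)
    (weightedSq_nonneg hPv (vel x))
  rw [weightedSq] at this
  linarith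

/-- The closed loop with the computed torque is the undamped linear field. -/
theorem closedLoop_computedTorque (Pv : Matrix (Fin n) (Fin n) ℝ) (hx : (M (pos x)).det ≠ 0) :
    closedLoop (mechDrift M C τ) (mechInput M) (computedTorque M C τ Kp Kd) x =
      dampedField Kp Kd Pv (fun _ => 0) x := by
  rw [closedLoop, mechDrift_add_mechInput (Kp := Kp) hx (-matVec Kd (vel x)), computedTorque,
    sub_self, matVec_zero, dampedField, zero_smul, neg_zero, add_zero, add_zero]

theorem closedLoop_of_isQPSolution (hPq : Pq.IsSymm) (hPv : Pv.PosDef)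
    (hx : (M (pos x)).det ≠ 0)
    (hs : -matVec Pv (vel x) = 0 → 0 ≤ slack Kp Pq Pv b α (-matVec Kd (vel x)) x)
    {u : MechState n → Vec (Fin n)}
    (hu : IsQPSolution (mechDrift M C τ) (mechInput M) (mechBarrier b Pq Pv) α (mechWeight M)
      (computedTorque M C τ Kp Kd x) x (u x)) :
    closedLoop (mechDrift M C τ) (mechInput M) u x =
      dampedField Kp Kd Pv (fun x => gain Kp Pq Pv b α (-matVec Kd (vel x)) x) x := by
  rw [closedLoop, dynamics_of_isQPSolution hPq hPv hx hs hu, dampedField, add_assoc]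

end ClosedLoop

/-! ### Local Lipschitz continuity of the closed loop -/

section Regularity

variable {n : ℕ} {Kp Kd Pv : Matrix (Fin n) (Fin n) ℝ} {b : ℝ} {α : ℝ → ℝ}

theorem contDiff_linear_feedback (Kp Kd : Matrix (Fin n) (Fin n) ℝ) :
    ContDiff ℝ 1 fun x : MechState n => -matVec Kp (pos x) + -matVec Kd (vel x) :=
  ((contDiff_matVec Kp).comp contDiff_pos).neg.add ((contDiff_matVec Kd).comp contDiff_vel).neg

theorem contDiff_mechBarrier (b : ℝ) (Pq Pv : Matrix (Fin n) (Fin n) ℝ) :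
    ContDiff ℝ 1 (mechBarrier b Pq Pv) :=
  contDiff_const.sub (contDiff_const.mul (((contDiff_weightedSq Pq).comp contDiff_pos).add
    ((contDiff_weightedSq Pv).comp contDiff_vel)))

theorem locallyLipschitz_slack (Kp Kd Pq Pv : Matrix (Fin n) (Fin n) ℝ) (b : ℝ)
    (hα : LocallyLipschitz α) :
    LocallyLipschitz fun x : MechState n => slack Kp Pq Pv b α (-matVec Kd (vel x)) x := by
  have h1 : ContDiff ℝ 1 fun x : MechState n => -inner ℝ (matVec Pq (pos x)) (vel x) -
      inner ℝ (matVec Pv (vel x)) (-matVec Kp (pos x) + -matVec Kd (vel x)) :=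
    (((contDiff_matVec Pq).comp contDiff_pos).inner ℝ contDiff_vel).neg.sub
      (((contDiff_matVec Pv).comp contDiff_vel).inner ℝ (contDiff_linear_feedback Kp Kd))
  exact h1.locallyLipschitz.add (hα.comp (contDiff_mechBarrier b Pq Pv).locallyLipschitz)

theorem vel_eq_zero_of_matVec {Pv : Matrix (Fin n) (Fin n) ℝ} (hPv : Pv.PosDef)
    {v : Vec (Fin n)} (h : matVec Pv v = 0) : v = 0 := by
  by_contra hv
  have := weightedSq_pos hPv hv
  simp [weightedSq, h] at this

/-- If the barrier does not depend on the position, the gain of the additional damping vanishes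
near the states at rest, and is locally Lipschitz. -/
theorem locallyLipschitz_gain (hPv : Pv.PosDef) (hα : LocallyLipschitz α) (hαb : 0 < α b) :
    LocallyLipschitz fun x : MechState n => gain Kp 0 Pv b α (-matVec Kd (vel x)) x := by
  have hslack := locallyLipschitz_slack Kp Kd 0 Pv b hα
  intro x
  by_cases hv : vel x = 0
  · have hpos : 0 < slack Kp 0 Pv b α (-matVec Kd (vel x)) x := by
      simp [slack, mechBarrier, hv, matVec_zero, weightedSq, zero_matVec, hαb]
    refine ⟨0, _, hslack.continuous.continuousAt.eventually_const_lt hpos, ?_⟩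
    have hz : ∀ y, 0 < slack Kp 0 Pv b α (-matVec Kd (vel y)) y →
        gain Kp 0 Pv b α (-matVec Kd (vel y)) y = 0 := fun y hy => by
      rw [gain, max_eq_left (neg_nonpos.2 hy.le), zero_div]
    intro y hy z hz'
    simp [hz y hy, hz z hz']
  · have hU : IsOpen {y : MechState n | vel y ≠ 0} :=
      isOpen_ne.preimage contDiff_vel.continuous
    have hnum : LocallyLipschitz fun x : MechState n =>
        max 0 (-slack Kp 0 Pv b α (-matVec Kd (vel x)) x) := hslack.neg.const_max 0
    have hden : LocallyLipschitzOn {y : MechState n | vel y ≠ 0}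
        fun x => (‖matVec Pv (vel x)‖ ^ 2)⁻¹ :=
      (LocallyLipschitz.id.locallyLipschitzOn).comp_contDiffAt
        (Φ := fun x : MechState n => (‖matVec Pv (vel x)‖ ^ 2)⁻¹) fun y hy =>
        (((contDiff_matVec Pv).comp contDiff_vel).norm_sq ℝ).contDiffAt.inv <| by
          have : matVec Pv (vel y) ≠ 0 := fun h => hy (vel_eq_zero_of_matVec hPv h)
          simpa using this
    obtain ⟨K, t, ht, hK⟩ := (hnum.locallyLipschitzOn.real_mul hden) hv
    exact ⟨K, t, by rwa [hU.nhdsWithin_eq hv] at ht, hK⟩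

theorem locallyLipschitz_dampedField {c : MechState n → ℝ} (hc : LocallyLipschitz c) :
    LocallyLipschitz (dampedField Kp Kd Pv c) := by
  have hid : LocallyLipschitz fun x : MechState n => (c x, x) := hc.prodMk LocallyLipschitz.id
  have hlin := (contDiff_linear_feedback (n := n) Kp Kd).comp (contDiff_snd (E := ℝ))
  have hvel := (contDiff_vel (n := n)).comp (contDiff_snd (E := ℝ))
  have hdamp := ((contDiff_fst (E := ℝ) (F := MechState n)).smul
    ((contDiff_matVec Pv).comp hvel)).neg
  have hΦ := (mkStateCLM (n := n)).contDiff.comp (hvel.prodMk (hlin.add hdamp))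
  intro x
  exact (hΦ.locallyLipschitz.comp hid) x

end Regularity

/-! ### Stabilizability, consequences of regularity, and invariance -/

section Stabilizable

variable {n : ℕ} {Q : Set (Vec (Fin n))} {M : Vec (Fin n) → Matrix (Fin n) (Fin n) ℝ}
  {C : Vec (Fin n) → Vec (Fin n) → Matrix (Fin n) (Fin n) ℝ} {τ : Vec (Fin n) → Vec (Fin n)}
  {Kp Kd Pq Pv : Matrix (Fin n) (Fin n) ℝ} {b : ℝ} {α : ℝ → ℝ} {E : Set (MechState n)} {ν : ℝ}

theorem matLocLipOn_inv_mass (hg : MatLocLipOn (mechDomain Q) (mechInput M)) :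
    MatLocLipOn (mechDomain Q) fun x => (M (pos x))⁻¹ := fun i j => hg (Sum.inr i) j

/-- The regularity of `g` concerns only `M⁻¹`; that of `M` is recovered by inverting again. -/
theorem matLocLipOn_mass (hdet : ∀ q ∈ Q, (M q).det ≠ 0)
    (hg : MatLocLipOn (mechDomain Q) (mechInput M)) :
    MatLocLipOn (mechDomain Q) fun x => M (pos x) := by
  intro i j
  refine ((matLocLipOn_inv_mass hg).inv (fun x hx => ?_) i j).congr fun x hx => ?_
  · rw [Matrix.det_nonsing_inv, Ring.inverse_eq_inv']
    exact inv_ne_zero (hdet _ hx)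
  · simp only [Matrix.nonsing_inv_nonsing_inv _ (isUnit_iff_ne_zero.2 (hdet _ hx))]

/-- Neither `C` nor `τ` is assumed Lipschitz separately. The sum `C v + τ` is `-M` times the
velocity component of the drift, which is Lipschitz. -/
theorem locallyLipschitzOn_computedTorque (hdet : ∀ q ∈ Q, (M q).det ≠ 0)
    (hf : LocallyLipschitzOn (mechDomain Q) (mechDrift M C τ))
    (hg : MatLocLipOn (mechDomain Q) (mechInput M)) :
    LocallyLipschitzOn (mechDomain Q) (computedTorque M C τ Kp Kd) := by
  have hM := matLocLipOn_mass hdet hg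
  have h1 : LocallyLipschitzOn (mechDomain Q) fun x => vel (mechDrift M C τ x) :=
    hf.comp_contDiffAt fun _ _ => contDiff_vel.contDiffAt
  have h2 := (contDiff_linear_feedback Kp Kd).locallyLipschitz.locallyLipschitzOn
    (s := mechDomain Q)
  refine ((hM.matVec h2).sub (hM.matVec h1)).congr fun x hx => ?_
  have h3 : matVec (M (pos x)) (vel (mechDrift M C τ x)) =
      -matVec (C (pos x) (vel x)) (vel x) - τ (pos x) := by
    rw [mechDrift_eq, vel_mkState, matVec_inv_matVec (hdet _ hx)]
  simp only [h3, computedTorque, torqueWithInput]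
  abel

theorem posDef_mechWeight {x : MechState n} (hx : (M (pos x)).det ≠ 0) :
    (mechWeight M x).PosDef := by
  have h := Matrix.PosDef.conjTranspose_mul_self (M (pos x))⁻¹
    (Matrix.mulVec_injective_of_isUnit (by
      rw [Matrix.isUnit_iff_isUnit_det, Matrix.det_nonsing_inv, Ring.inverse_eq_inv']
      exact isUnit_iff_ne_zero.2 (inv_ne_zero hx)))
  rwa [Matrix.conjTranspose_eq_transpose_of_trivial] at h

theorem lieF_closedLoop_computedTorque (hKp : Kp.PosDef) {x : MechState n}
    (hx : (M (pos x)).det ≠ 0) :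
    lieF (closedLoop (mechDrift M C τ) (mechInput M) (computedTorque M C τ Kp Kd))
      (mechLyapunov Kp) x = -weightedSq Kd (vel x) := by
  rw [lieF, closedLoop_computedTorque 0 hx, (hasGradientAt_mechLyapunov hKp x).gradient,
    inner_lyapunov_gradient_dampedField, zero_mul, sub_zero]

theorem lyapunovAssumption_computedTorque (hdet : ∀ q ∈ Q, (M q).det ≠ 0)
    (hf : LocallyLipschitzOn (mechDomain Q) (mechDrift M C τ))
    (hg : MatLocLipOn (mechDomain Q) (mechInput M)) (hKp : Kp.PosDef) (hKd : Kd.PosDef)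
    (hD : mechDomain Q ∈ 𝓝 (0 : MechState n)) :
    LyapunovAssumption (mechDomain Q) (mechDrift M C τ) (mechInput M)
      (computedTorque M C τ Kp Kd) (mechLyapunov Kp) where
  locLip := locallyLipschitzOn_computedTorque hdet hf hg
  contDiff := (contDiff_mechLyapunov Kp).contDiffOn
  map_zero := mechLyapunov_zero Kp
  pos x _ hx := by
    obtain ⟨m, hm, h⟩ := exists_mechLyapunov_coercive hKp
    have : 0 < ‖x‖ := norm_pos_iff.2 hx
    exact lt_of_lt_of_le (by positivity) (h x)
  nonincreasing x hx := by
    rw [lieF_closedLoop_computedTorque hKp (hdet _ hx)]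
    exact neg_nonpos.2 (weightedSq_nonneg hKd _)
  stable := asymptoticallyStable_of_eqOn_dampedField hKp hKd (Matrix.PosDef.one (n := Fin n))
    (c := fun _ => 0) (fun _ => le_rfl) continuous_const
    (locallyLipschitz_dampedField (LocallyLipschitz.const 0)) hD
    fun x hx => closedLoop_computedTorque 1 (hdet _ hx)
  laSalle x hx hV t ht := by
    -- Zero dissipation forces `v = 0` for all time. Then `0 = v' = -K_p q`, so `q = 0` too.
    have hvel : ∀ s ∈ Ici (0 : ℝ), vel (x s) = 0 := fun s hs => by
      by_contra hne
      have h1 := hV s hs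
      rw [lieF_closedLoop_computedTorque hKp (hdet _ (hx s hs).1)] at h1
      have := weightedSq_pos hKd hne
      linarith
    have hder := velCLM.hasFDerivAt.comp_hasDerivWithinAt t (hx t ht).2
    have hder0 : HasDerivWithinAt (velCLM ∘ x) 0 (Ici 0) t :=
      (hasDerivWithinAt_const t (Ici 0) (0 : Vec (Fin n))).congr (fun s hs => hvel s hs)
        (hvel t ht)
    have h0 := (uniqueDiffOn_Ici (0 : ℝ) t ht).eq_deriv _ hder hder0
    rw [closedLoop_computedTorque 1 (hdet _ (hx t ht).1), velCLM_apply, dampedField, vel_mkState,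
      hvel t ht] at h0
    simp only [matVec_zero, smul_zero, neg_zero, add_zero, neg_eq_zero] at h0
    rw [← mkState_pos_vel (x t), hvel t ht, vel_eq_zero_of_matVec hKp h0]
    ext i
    cases i <;> rfl

/-- The weight is chosen so that `M⁻¹ G⁻¹ M⁻ᵀ = 1`; what remains is the product of the velocity
gradients `v` and `-P_v v`. -/
theorem weighted_gradient_product (hKp : Kp.PosDef) (hPq : Pq.IsSymm) (hPv : Pv.PosDef)
    {x : MechState n} (hx : (M (pos x)).det ≠ 0) :
    inner ℝ (gradient (mechLyapunov Kp) x)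
      (matVec (mechInput M x * (mechWeight M x)⁻¹ * (mechInput M x).transpose)
        (gradient (mechBarrier b Pq Pv) x)) = -weightedSq Pv (vel x) := by
  have hlie : matVec (mechInput M x).transpose (gradient (mechBarrier b Pq Pv) x) =
      -matVec (M (pos x))⁻¹.transpose (matVec Pv (vel x)) := lieG_mechBarrier hPq hPv
  have hG : (M (pos x))⁻¹ * ((mechWeight M x)⁻¹ * (M (pos x))⁻¹.transpose) = 1 := by
    have hu : IsUnit (M (pos x)).det := isUnit_iff_ne_zero.2 hx
    rw [mechWeight, Matrix.mul_inv_rev, Matrix.nonsing_inv_nonsing_inv _ hu, mul_assoc,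
      Matrix.nonsing_inv_mul, mul_one, Matrix.nonsing_inv_mul _ hu]
    rw [Matrix.det_transpose, Matrix.det_nonsing_inv, Ring.inverse_eq_inv']
    exact isUnit_iff_ne_zero.2 (inv_ne_zero hx)
  rw [mul_matVec, mul_matVec, hlie, matVec_mechInput, matVec_neg, matVec_neg, ← mul_matVec,
    ← mul_matVec, mul_assoc, hG, one_matVec, (hasGradientAt_mechLyapunov hKp x).gradient,
    inner_mkState, pos_mkState, vel_mkState, inner_zero_right, zero_add, inner_neg_right]
  rfl

theorem barrier_condition_at_rest (hPq : Pq.IsSymm) (hPv : Pv.PosDef) {x : MechState n}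
    (hx : (M (pos x)).det ≠ 0) (hv : vel x = 0) :
    lieF (mechDrift M C τ) (mechBarrier b Pq Pv) x +
      inner ℝ (lieG (mechInput M) (mechBarrier b Pq Pv) x) (computedTorque M C τ Kp Kd x) +
      α (mechBarrier b Pq Pv x) = α (mechBarrier b Pq Pv x) := by
  rw [lieF_add_lieG, mechDrift_add_mechInput (Kp := Kp) hx (-matVec Kd (vel x)),
    barrier_condition_eq hPq hPv, slack, hv]
  simp [matVec_zero]

theorem cbfStabilizable_computedTorque (hdet : ∀ q ∈ Q, (M q).det ≠ 0)
    (hf : LocallyLipschitzOn (mechDomain Q) (mechDrift M C τ))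
    (hg : MatLocLipOn (mechDomain Q) (mechInput M)) (hKp : Kp.PosDef) (hKd : Kd.PosDef)
    (hPq : Pq.IsSymm) (hPv : Pv.PosDef)
    (hZ : ZCBFAssumption (mechDomain Q) (mechDrift M C τ) (mechInput M) (mechBarrier b Pq Pv) E α)
    (hν : 0 < ν) :
    CBFStabilizable (mechDomain Q) (mechDrift M C τ) (mechInput M) (mechBarrier b Pq Pv) E α
      (computedTorque M C τ Kp Kd) (mechLyapunov Kp) (mechWeight M) ν where
  zcbf := hZ
  lyapunov := lyapunovAssumption_computedTorque hdet hf hg hKp hKd <|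
    mem_of_superset (mem_interior_iff_mem_nhds.1 hZ.zero_mem_interior) fun _ hx => hx.1
  weight_locLip := (matLocLipOn_inv_mass hg).transpose.mul (matLocLipOn_inv_mass hg)
  weight_posDef x hx := posDef_mechWeight (hdet _ hx)
  level_pos := hν
  exists_exceptional_set := by
    -- The exceptional states are those at rest, where the barrier expression reduces to `α(h) ≥ 0`.
    refine ⟨{x | vel x = 0} ∩ (levelSet (mechDomain Q) (mechLyapunov Kp) ν ∩
      constraintSet (mechDomain Q) (mechBarrier b Pq Pv)), inter_subset_right, ?_, ?_⟩
    · rintro x ⟨hx, hxA⟩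
      rw [weighted_gradient_product hKp hPq hPv (hdet _ hx.1.1)]
      exact neg_neg_of_pos (weightedSq_pos hPv fun hv => hxA ⟨hv, hx⟩)
    · rintro x ⟨hv, hx⟩
      rw [barrier_condition_at_rest hPq hPv (hdet _ hx.1.1) hv, ← hZ.classK.2.2]
      exact hZ.classK.2.1.monotone hx.2.2

/-- Under the regularity condition on `L_g h`, the barrier does not depend on the position: near
the origin, `L_g h` vanishes at the states at rest. -/
theorem eq_zero_of_lieRegular (hPq : Pq.IsSymm) (hPv : Pv.PosDef) (hν : 0 < ν)
    (hD : mechDomain Q ∈ 𝓝 (0 : MechState n)) (hE : E ∈ 𝓝 (0 : MechState n))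
    (hreg : LieRegular (mechDomain Q) (mechInput M) (mechBarrier b Pq Pv) E
      (levelSet (mechDomain Q) (mechLyapunov Kp) ν)) : Pq = 0 := by
  have hnhds : levelSet (mechDomain Q) (mechLyapunov Kp) ν ∩ E ∈ 𝓝 (0 : MechState n) := by
    refine inter_mem (inter_mem hD ?_) hE
    filter_upwards [(contDiff_mechLyapunov Kp).continuous.continuousAt.eventually_lt_const
      ((mechLyapunov_zero Kp).trans_lt hν)] with x hx using hx.le
  have hlie : ∀ x : MechState n, vel x = 0 →
      lieG (mechInput M) (mechBarrier b Pq Pv) x = 0 := fun x hx => by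
    rw [lieG_mechBarrier hPq hPv, hx, matVec_zero, matVec_zero, neg_zero]
  rcases hreg with hreg | hreg
  -- The first alternative is never possible: it fails at the origin.
  · exact absurd (hlie 0 rfl) (hreg 0 (mem_of_mem_nhds hnhds))
  · refine eq_zero_of_matVec_eq_zero fun q => ?_
    -- Any position can be scaled into the neighbourhood, and `P_q` is linear.
    have hcont : Tendsto (fun s : ℝ => s • mkState q 0) (𝓝[>] 0) (𝓝 0) := by
      have : Continuous fun s : ℝ => s • mkState q 0 := by fun_prop
      exact (this.tendsto' 0 0 (zero_smul _ _)).mono_left nhdsWithin_le_nhds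
    obtain ⟨s, hs, hs0⟩ := ((hcont.eventually hnhds).and self_mem_nhdsWithin).exists
    have hvel : vel (s • mkState q 0) = 0 := (velCLM.map_smul s (mkState q 0)).trans (smul_zero s)
    have hgrad := (hreg _ hs (hlie _ hvel)).2
    rw [(hasGradientAt_mechBarrier b hPq hPv _).gradient, neg_eq_zero] at hgrad
    have hpos : pos (s • mkState q 0) = s • q := posCLM.map_smul s (mkState q 0)
    have h0 : matVec Pq (s • q) = 0 := by rw [← hpos]; exact congrArg pos hgrad
    rw [matVec_smul] at h0
    exact (smul_eq_zero.1 h0).resolve_left (ne_of_gt hs0)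

/-- The barrier increases along the damped dynamics wherever it is negative. -/
theorem barrier_derivative_nonneg (hPv : Pv.PosDef) (hb : 0 < b) (hα : IsExtClassK α)
    {x : MechState n} (hx : mechBarrier b 0 Pv x < 0) :
    0 ≤ inner ℝ (-mkState (matVec 0 (pos x)) (matVec Pv (vel x)))
      (dampedField Kp Kd Pv (fun x => gain Kp 0 Pv b α (-matVec Kd (vel x)) x) x) := by
  -- At rest the barrier is `b > 0`, so a state with negative barrier is moving and the projection
  -- is feasible there. The control barrier condition is not needed, hence the argument also covers
  -- states outside `E`.
  have hs : -matVec Pv (vel x) = 0 → 0 ≤ slack Kp 0 Pv b α (-matVec Kd (vel x)) x := fun h => by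
    have hv : vel x = 0 := vel_eq_zero_of_matVec hPv (neg_eq_zero.1 h)
    simp [mechBarrier, hv, weightedSq, zero_matVec] at hx
    exact absurd hx hb.not_gt
  have h1 := (halfspace_projection hs).1
  rw [norm_neg, smul_neg] at h1
  have h2 := barrier_condition_eq (Kp := Kp) (b := b) (α := α) (x := x)
    (Matrix.transpose_zero : (0 : Matrix (Fin n) (Fin n) ℝ).IsSymm) hPv (-matVec Kd (vel x))
    (-(gain Kp 0 Pv b α (-matVec Kd (vel x)) x • matVec Pv (vel x)))
  rw [(hasGradientAt_mechBarrier b Matrix.transpose_zero hPv x).gradient] at h2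
  have h3 : α (mechBarrier b 0 Pv x) < 0 := by
    rw [← hα.2.2]
    exact hα.2.1 hx
  rw [dampedField, add_assoc]
  rw [gain] at h2 ⊢
  linarith

/-- All arguments run on the global damped field. Its solution keeps `V ≤ ν`, hence stays in the
domain by `hΓ`, and keeps `h ≥ 0`, hence stays in `E`, where it solves the actual closed loop.
Conversely, any solution in `E` solves the damped equation, which gives uniqueness and convergence.
-/
theorem invariant_and_attracted (hKp : Kp.PosDef) (hKd : Kd.PosDef) (hPv : Pv.PosDef)
    (hb : 0 < b) (hα : IsExtClassK α) (hα' : LocallyLipschitz α)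
    (hE : constraintSet (mechDomain Q) (mechBarrier b 0 Pv) ⊆ E) (hE0 : E ∈ 𝓝 0)
    (hΓ : {x : MechState n | mechLyapunov Kp x ≤ ν} ⊆ mechDomain Q)
    {F : MechState n → MechState n}
    (hF : EqOn F (dampedField Kp Kd Pv fun x => gain Kp 0 Pv b α (-matVec Kd (vel x)) x) E) :
    InvariantForAllTime E F (levelSet (mechDomain Q) (mechLyapunov Kp) ν ∩
        constraintSet (mechDomain Q) (mechBarrier b 0 Pv)) ∧
      AsymptoticallyStable E F ∧
      ∀ x, IsSolution E F (Ici 0) x → Tendsto x atTop (𝓝 0) := by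
  have hαb : 0 < α b := by
    rw [← hα.2.2]
    exact hα.2.1 hb
  set c : MechState n → ℝ := fun x => gain Kp 0 Pv b α (-matVec Kd (vel x)) x with hc
  have hc0 : ∀ x, 0 ≤ c x := fun x => gain_nonneg _ _
  have hcL : LocallyLipschitz c := locallyLipschitz_gain hPv hα' hαb
  have hL : LocallyLipschitz (dampedField Kp Kd Pv c) := locallyLipschitz_dampedField hcL
  refine ⟨fun x₀ hx₀ => ?_, asymptoticallyStable_of_eqOn_dampedField hKp hKd hPv hc0
    hcL.continuous hL hE0 hF, fun x hx => tendsto_zero_of_dampedField hKp hKd hPv hc0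
      hcL.continuous fun t ht => by rw [← hF (hx t ht).1]; exact (hx t ht).2⟩
  obtain ⟨x, hx0, hx⟩ := exists_solution_dampedField hKp hKd hPv hc0 hL x₀
  have hV : ∀ t ∈ Ici (0 : ℝ), mechLyapunov Kp (x t) ≤ ν := fun t ht => by
    have := lyapunov_antitoneOn hKp hKd hPv hc0 (convex_Ici 0) hx (mem_Ici.2 le_rfl) ht ht
    refine this.trans ?_
    simpa only [hx0] using hx₀.1.2
  have hh : ∀ t ∈ Ici (0 : ℝ), 0 ≤ mechBarrier b 0 Pv (x t) :=
    nonneg_of_hasDerivWithinAt_nonneg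
      (fun t ht => (hasGradientAt_mechBarrier b Matrix.transpose_zero hPv
        (x t)).hasFDerivAt.comp_hasDerivWithinAt t (hx t ht))
      (by simpa only [Function.comp_apply, hx0] using hx₀.2.2)
      fun t _ hneg => barrier_derivative_nonneg hPv hb hα hneg
  have hS : ∀ t, 0 ≤ t → x t ∈ levelSet (mechDomain Q) (mechLyapunov Kp) ν ∩
      constraintSet (mechDomain Q) (mechBarrier b 0 Pv) := fun t ht =>
    ⟨⟨hΓ (hV t ht), hV t ht⟩, hΓ (hV t ht), hh t ht⟩
  refine ⟨x, fun t ht => ⟨hE (hS t ht).2, ?_⟩, hx0, hS, fun T y hy hy0 => ?_⟩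
  · rw [hF (hE (hS t ht).2)]
    exact hx t ht
  · exact eqOn_of_solutions_dampedField hKp hKd hPv hc0 hL
      (fun t ht => by rw [← hF (hy t ht).1]; exact (hy t ht).2)
      (fun t ht => (hx t ht.1).mono Ico_subset_Ici_self) (hy0.trans hx0.symm)

end Stabilizable

end SafeControl

end

theorem mainTheorem4 (n : ℕ)
    (Q : Set (Vec (Fin n)))
    (M : Vec (Fin n) → Matrix (Fin n) (Fin n) ℝ)
    (C : Vec (Fin n) → Vec (Fin n) → Matrix (Fin n) (Fin n) ℝ)
    (τ : Vec (Fin n) → Vec (Fin n))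
    (hM : ∀ q ∈ Q, ∀ w : Vec (Fin n), w ≠ 0 → 0 < weightedSq (M q) w)
    (hf : LocallyLipschitzOn (mechDomain Q) (mechDrift M C τ))
    (hg : MatLocLipOn (mechDomain Q) (mechInput M))
    (Kp Kd : Matrix (Fin n) (Fin n) ℝ) (hKp : Kp.PosDef) (hKd : Kd.PosDef)
    (b : ℝ) (hb : 0 < b)
    (Pq Pv : Matrix (Fin n) (Fin n) ℝ) (hPq : Pq.IsSymm) (hPv : Pv.PosDef)
    (E : Set (MechState n)) (α : ℝ → ℝ)
    (hZ : ZCBFAssumption (mechDomain Q) (mechDrift M C τ)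
      (mechInput M) (mechBarrier b Pq Pv) E α)
    (ν : ℝ) (hν : 0 < ν) :
    CBFStabilizable (mechDomain Q) (mechDrift M C τ)
      (mechInput M) (mechBarrier b Pq Pv) E α
      (computedTorque M C τ Kp Kd) (mechLyapunov Kp)
      (mechWeight M) ν ∧
    ({x : MechState n | mechLyapunov Kp x ≤ ν} ⊆ mechDomain Q →
      LieRegular (mechDomain Q) (mechInput M)
        (mechBarrier b Pq Pv) E
        (levelSet (mechDomain Q) (mechLyapunov Kp) ν) →
      -- the quadratic program has exactly one solution, for each input term
      (∀ x ∈ E, ∀ μ : Vec (Fin n), ∃! u : Vec (Fin n),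
        IsQPSolution (mechDrift M C τ) (mechInput M)
          (mechBarrier b Pq Pv) α (mechWeight M)
          (torqueWithInput M C τ Kp x μ) x u) ∧
      -- the closed loop with the solution of the quadratic program
      (∀ ustar : MechState n → Vec (Fin n),
        (∀ x ∈ E, IsQPSolution (mechDrift M C τ) (mechInput M)
          (mechBarrier b Pq Pv) α (mechWeight M)
          (computedTorque M C τ Kp Kd x) x (ustar x)) →
        InvariantForAllTime E
          (closedLoop (mechDrift M C τ) (mechInput M) ustar)
          (levelSet (mechDomain Q) (mechLyapunov Kp) ν ∩
            constraintSet (mechDomain Q)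
              (mechBarrier b Pq Pv)) ∧
        AsymptoticallyStable E
          (closedLoop (mechDrift M C τ) (mechInput M) ustar) ∧
        AttractedFrom E
          (closedLoop (mechDrift M C τ) (mechInput M) ustar)
          (levelSet (mechDomain Q) (mechLyapunov Kp) ν ∩
            constraintSet (mechDomain Q)
              (mechBarrier b Pq Pv)) ∧
        ∀ x ∈ E,
          inner ℝ (gradient (mechLyapunov Kp) x)
            (closedLoop (mechDrift M C τ) (mechInput M) ustar x)
          ≤ inner ℝ (-matVec Kd (vel x)) (vel x)) ∧
      -- passivity with the damping term replaced by a free input term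
      (∀ umu : MechState n → Vec (Fin n) → Vec (Fin n),
        (∀ x ∈ E, ∀ μ, IsQPSolution (mechDrift M C τ)
          (mechInput M) (mechBarrier b Pq Pv) α (mechWeight M)
          (torqueWithInput M C τ Kp x μ) x (umu x μ)) →
        PassiveWith E
          (fun x μ => mechDrift M C τ x +
            matVec (mechInput M x) (umu x μ))
          vel (mechLyapunov Kp))) := by
  have hdet : ∀ q ∈ Q, (M q).det ≠ 0 := fun q hq => det_ne_zero_of_weightedSq_pos (hM q hq)
  have hE0 : E ∈ 𝓝 (0 : MechState n) := mem_of_superset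
    (mem_interior_iff_mem_nhds.1 hZ.zero_mem_interior) hZ.constraint_subset
  have hD0 : mechDomain Q ∈ 𝓝 (0 : MechState n) := mem_of_superset hE0 hZ.subset_domain
  have hdetE : ∀ x ∈ E, (M (pos x)).det ≠ 0 := fun x hx => hdet _ (hZ.subset_domain hx)
  have hslack : ∀ x ∈ E, ∀ μ, -matVec Pv (vel x) = 0 → 0 ≤ slack Kp Pq Pv b α μ x :=
    fun x hx μ => slack_nonneg_of_sup hPq hPv (hdetE x hx) (hZ.sup_nonneg x hx) μ
  refine ⟨cbfStabilizable_computedTorque hdet hf hg hKp hKd hPq hPv hZ hν,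
    fun hΓ hreg => ⟨fun x hx μ => ?_, fun ustar hu => ?_, fun umu hu => ?_⟩⟩
  · exact ⟨_, (isQPSolution_iff hPq hPv (hdetE x hx) (hslack x hx μ) _).2 rfl,
      fun u hu => (isQPSolution_iff hPq hPv (hdetE x hx) (hslack x hx μ) u).1 hu⟩
  · have hdiss : ∀ x ∈ E, inner ℝ (gradient (mechLyapunov Kp) x)
        (closedLoop (mechDrift M C τ) (mechInput M) ustar x) ≤
          inner ℝ (-matVec Kd (vel x)) (vel x) := fun x hx =>
      dissipation_of_isQPSolution hKp hPq hPv (hdetE x hx) (hslack x hx _) (hu x hx)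
    -- Only invariance, stability and attraction need `P_q = 0`; solvability of the program and
    -- passivity hold for every symmetric `P_q`.
    obtain rfl : Pq = 0 := eq_zero_of_lieRegular hPq hPv hν hD0 hE0 hreg
    obtain ⟨h1, h2, h3⟩ := invariant_and_attracted hKp hKd hPv hb hZ.classK hZ.locLip
      hZ.constraint_subset hE0 hΓ fun x hx =>
        closedLoop_of_isQPSolution hPq hPv (hdetE x hx) (hslack x hx _) (hu x hx)
    exact ⟨h1, h2, fun x hx _ => h3 x hx, hdiss⟩
  · exact ⟨(contDiff_mechLyapunov Kp).contDiffOn, mechLyapunov_zero Kp,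
      fun x _ => mechLyapunov_nonneg hKp x, fun x hx μ =>
        dissipation_of_isQPSolution hKp hPq hPv (hdetE x hx) (hslack x hx μ) (hu x hx μ)⟩
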